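/- Let $\delta\in[0,1]$. The adder-erasure random access channel with $k$ active transmitters has inputs $X_1,\dots,X_k\in\{0,1\}$ and output $Y_k\in\{0,\dots,k\}\cup\{\mathsf e\}$, where $Y_k=\sum_{i=1}^k X_i$ with probability $1-\delta$ and $Y_k=\mathsf e$ (erasure) with probability $\delta$, the erasure being independent of the inputs. For independent inputs $X_{[k]}=(X_1,\dots,X_k)$ with distributions $P_{X_1},\dots,P_{X_k}$ let $$\imath_k(x_{[k]};y)=\ln\frac{P_{Y_k|X_{[k]}}(y|x_{[k]})}{P_{Y_k}(y)},\qquad I_k=\mathbb E[\imath_k(X_{[k]};Y_k)],\qquad V_k=\mathrm{Var}[\imath_k(X_{[k]};Y_k)],$$ and let the sum-rate capacity be the supremum of $I_k$ over all product input distributions $P_{X_1}\cdots P_{X_k}$. Then for every $k$ the equiprobable distribution $P_{X_1}=\dots=P_{X_k}=\mathrm{Bernoulli}(1/2)$ maximizes $I_k$ over all product input distributions, it is the only maximizer if $\delta<1$, and it achieves the sum-rate capacity. For this input distribution and fixed $\delta$, as $k\to\infty$, $$I_k=(1-\delta)\left(\frac12\ln\frac{\pi e k}{2}-\frac1{12k^2}\right)+O(k^{-3})\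 \text{nats},$$ $$V_k=(1-\delta)\left[\frac{\delta}{4}\ln^2\frac{\pi e k}{2}+\frac12-\frac1{2k}-\left(\frac12+\frac{\delta\ln\frac{\pi e k}{2}}{12}\right)\frac1{k^2}\right]+O\!\left(\frac{\ln k}{k^3}\right)\ \text{nats}^2.$$ -/

import Mathlib

open scoped Asymptotics

noncomputable section

namespace RAC

/-- Conditional output law of the adder-erasure channel with `k` active transmitters and erasure
probability `δ`: the probability of the output `y` given the binary inputs `x`. The output `none` is
the erasure symbol, `some j` is the value `j ∈ {0, …, k}` of the sum of the inputs. -/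
def adderErasure (δ : ℝ) (k : ℕ) (x : Fin k → Fin 2) : Option (Fin (k + 1)) → ℝ
  | none => δ
  | some j => if ∑ i, (x i : ℕ) = (j : ℕ) then 1 - δ else 0

section Information

variable {k : ℕ} {X Y : Type*} [Fintype X] [Fintype Y]

/-- Families of `k` probability mass functions on the alphabet `X`, one for each transmitter. -/
def inputLaws (k : ℕ) (X : Type*) [Fintype X] : Set (Fin k → X → ℝ) :=
  {P | ∀ i, P i ∈ stdSimplex ℝ X}

/-- Joint probability mass function of independent inputs with marginals `P i`. -/
def jointInput (P : Fin k → X → ℝ) (x : Fin k → X) : ℝ := ∏ i, P i (x i)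

/-- Expectation of `f (X_[k], Y_k)` for independent inputs with marginals `P i`, and `Y_k` the output
of the channel `W`. -/
def expect (W : (Fin k → X) → Y → ℝ) (P : Fin k → X → ℝ) (f : (Fin k → X) → Y → ℝ) : ℝ :=
  ∑ x, ∑ y, jointInput P x * W x y * f x y

/-- The marginal law of the output `Y_k`. -/
def outputLaw (W : (Fin k → X) → Y → ℝ) (P : Fin k → X → ℝ) (y : Y) : ℝ :=
  ∑ x, jointInput P x * W x y

/-- The information density `ı_k(x; y)`, in nats. -/
def infoDensity (W : (Fin k → X) → Y → ℝ) (P : Fin k → X → ℝ) (x : Fin k → X) (y : Y) : ℝ :=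
  Real.log (W x y / outputLaw W P y)

/-- The mutual information `I_k(X_[k]; Y_k)`, in nats. -/
def mutualInfo (W : (Fin k → X) → Y → ℝ) (P : Fin k → X → ℝ) : ℝ :=
  expect W P (infoDensity W P)

/-- The dispersion `V_k(X_[k]; Y_k)`, the variance of the information density, in squared nats. -/
def dispersion (W : (Fin k → X) → Y → ℝ) (P : Fin k → X → ℝ) : ℝ :=
  expect W P (fun x y => (infoDensity W P x y - mutualInfo W P) ^ 2)

/-- The sum-rate capacity: the supremum of the mutual information over independent inputs. -/
def sumRateCapacity (W : (Fin k → X) → Y → ℝ) : ℝ :=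
  sSup (mutualInfo W '' inputLaws k X)

end Information

/-- The equiprobable (Bernoulli(1/2)) distribution at each of the `k` encoders. -/
def equiprobable (k : ℕ) : Fin k → Fin 2 → ℝ := fun _ _ => 1 / 2

/-- The rows of the adder-erasure channel are probability mass functions. -/
theorem adderErasure_mem_stdSimplex {δ : ℝ} (hδ : δ ∈ Set.Icc (0 : ℝ) 1) (k : ℕ)
    (x : Fin k → Fin 2) : adderErasure δ k x ∈ stdSimplex ℝ (Option (Fin (k + 1))) := by
  have hlt : ∑ i, (x i : ℕ) < k + 1 := by
    have h : ∑ i, (x i : ℕ) ≤ ∑ _i : Fin k, 1 := Finset.sum_le_sum fun i _ => by omega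
    simp only [Finset.sum_const, Finset.card_univ, Fintype.card_fin, smul_eq_mul, mul_one] at h
    omega
  refine ⟨?_, ?_⟩
  · rintro (_ | j)
    · exact hδ.1
    · simp only [adderErasure]
      split_ifs
      · linarith [hδ.2]
      · exact le_rfl
  · rw [Fintype.sum_option]
    have h : ∀ j : Fin (k + 1), adderErasure δ k x (some j)
        = if (⟨∑ i, (x i : ℕ), hlt⟩ : Fin (k + 1)) = j then 1 - δ else 0 := by
      intro j
      simp only [adderErasure, Fin.ext_iff]
    simp only [h, Finset.sum_ite_eq, Finset.mem_univ, if_true]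
    simp [adderErasure]

end RAC

end

/-!
Let `f` be the law of `S = X₁ + ⋯ + X_k`. The information density is `0` on erasures and `-log f(S)`
otherwise, so `I = (1 - δ) H(S)` and, for the equiprobable inputs,
`V = (1 - δ) (Var (log f(S)) + δ H(S) ^ 2)`.

**Optimality.** `f` is the coefficient sequence of `∏ (1 - pᵢ + pᵢ X)`. The partial derivatives of
the entropy in the parameters `pᵢ` and `p_l` differ, after a summation by parts, by `p_l - pᵢ` times
an average of `log (f_{j+1} ^ 2 / (f_j f_{j+2}))`, which is positive because `f` is strictly
log-concave (`sumPoly_strict_logConcave`). Hence the entropy strictly increases along the segment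
from `p` to its constant average (`sumEntropy_lt_average`). For constant parameter `p` and `m + 1`
transmitters the derivative of the entropy is `m + 1` times
`log ((1 - p) / p) + E log ((J + 1) / (m + 1 - J))` with `J` binomial with `m` trials
(`binomialEntropySlope`). It vanishes at `1 / 2` by symmetry, and it is strictly decreasing since
`m E'[1 / (J + 1)] < 1 / p` and `m E'[1 / (m - J)] < 1 / (1 - p)`, where `E'` is the average over
`m - 1` trials. Both steps only differentiate at parameters inside `(0, 1)`; degenerate parameters
are reached by continuity.

**Asymptotics.** For `p = 1 / 2` put `x = (2 S - n) ^ 2 / n`. Stirling's formula with its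
`1 / (12 m)` correction and an error `O(m ^ (-3))` gives
`log f(S) = c_n - x / 2 - (x ^ 2 / 12 - x / 2) / n - (x ^ 3 / 30 - x ^ 2 / 4 + x / 3) / n ^ 2 + R`
with `c_n = -log (π n / 2) / 2 - 1 / (4 n)` and `|R| ≤ C (1 + x ^ 4) / n ^ 3`
(`abs_log_choose_sub_le`). The bound on `R` holds at every value of `S`: in the tails `n ≤ 4 x`, so
that the crude bound `6 n` is of the right form. All moments of `x` are bounded uniformly in `n`, so
`R` contributes `O(n ^ (-3))` to the mean and the variance, and the exact moments of `x` up to order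
four give the stated coefficients.
-/

/-! ### Reduction of the channel to the law of the sum of its inputs -/

open Polynomial in
/-- The generating polynomial `∏ i ∈ A, (1 - p i + p i X)` of a sum of independent Bernoulli
variables with parameters `p i`; its coefficients are the law of the sum. -/
noncomputable def sumPoly {ι : Type*} (p : ι → ℝ) (A : Finset ι) : ℝ[X] :=
  ∏ i ∈ A, (C (1 - p i) + C (p i) * X)

/-- The entropy, in nats, of a sum of independent Bernoulli variables with parameters `p i`. -/
noncomputable def sumEntropy {ι : Type*} [Fintype ι] (p : ι → ℝ) : ℝ :=
  ∑ j ∈ Finset.range (Fintype.card ι + 1), Real.negMulLog ((sumPoly p Finset.univ).coeff j)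

namespace RAC

theorem one_sub_of_mem_inputLaws {k : ℕ} {P : Fin k → Fin 2 → ℝ} (hP : P ∈ inputLaws k (Fin 2))
    (i : Fin k) : P i 0 = 1 - P i 1 := by
  have := (hP i).2
  rw [Fin.sum_univ_two] at this
  linarith

theorem mem_Icc_of_mem_inputLaws {k : ℕ} {P : Fin k → Fin 2 → ℝ} (hP : P ∈ inputLaws k (Fin 2))
    (i : Fin k) : P i 1 ∈ Set.Icc (0 : ℝ) 1 := by
  have h0 := one_sub_of_mem_inputLaws hP i
  have := (hP i).1 0
  exact ⟨(hP i).1 1, by linarith⟩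

theorem sum_val_lt {k : ℕ} (x : Fin k → Fin 2) : ∑ i, (x i : ℕ) < k + 1 := by
  have h : ∑ i, (x i : ℕ) ≤ ∑ _i : Fin k, 1 := Finset.sum_le_sum fun i _ => by omega
  simp only [Finset.sum_const, Finset.card_univ, Fintype.card_fin, smul_eq_mul, mul_one] at h
  omega

open Polynomial in
theorem sumPoly_eq_sum_jointInput {k : ℕ} {P : Fin k → Fin 2 → ℝ}
    (hP : P ∈ inputLaws k (Fin 2)) :
    sumPoly (fun i => P i 1) Finset.univ
      = ∑ x : Fin k → Fin 2, C (jointInput P x) * X ^ (∑ i, (x i : ℕ)) := by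
  have h : ∀ i, C (1 - P i 1) + C (P i 1) * X = ∑ b : Fin 2, C (P i b) * X ^ (b : ℕ) := by
    intro i
    rw [Fin.sum_univ_two, one_sub_of_mem_inputLaws hP i]
    simp
  simp only [sumPoly, h]
  rw [Finset.prod_univ_sum]
  simp only [Fintype.piFinset_univ, jointInput, map_prod, Finset.prod_mul_distrib,
    Finset.prod_pow_eq_pow_sum]

theorem coeff_sumPoly_eq {k : ℕ} {P : Fin k → Fin 2 → ℝ} (hP : P ∈ inputLaws k (Fin 2)) (j : ℕ) :
    (sumPoly (fun i => P i 1) Finset.univ).coeff j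
      = ∑ x : Fin k → Fin 2, if ∑ i, (x i : ℕ) = j then jointInput P x else 0 := by
  rw [sumPoly_eq_sum_jointInput hP, Polynomial.finsetSum_coeff]
  refine Finset.sum_congr rfl fun x _ => ?_
  rw [Polynomial.coeff_C_mul_X_pow]
  simp only [eq_comm]

/-- Change of variables: a function of the number of ones is averaged against the law of the sum. -/
theorem sum_jointInput_mul {k : ℕ} {P : Fin k → Fin 2 → ℝ} (hP : P ∈ inputLaws k (Fin 2))
    (h : ℕ → ℝ) :
    ∑ x : Fin k → Fin 2, jointInput P x * h (∑ i, (x i : ℕ))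
      = ∑ j ∈ Finset.range (k + 1), (sumPoly (fun i => P i 1) Finset.univ).coeff j * h j := by
  simp only [coeff_sumPoly_eq hP, Finset.sum_mul]
  rw [Finset.sum_comm]
  refine Finset.sum_congr rfl fun x _ => ?_
  rw [Finset.sum_eq_single_of_mem (∑ i, (x i : ℕ)) (Finset.mem_range.2 (sum_val_lt x))]
  · simp
  · intro b _ hb
    rw [if_neg (Ne.symm hb), zero_mul]

theorem sum_jointInput {k : ℕ} {P : Fin k → Fin 2 → ℝ} (hP : P ∈ inputLaws k (Fin 2)) :
    ∑ x : Fin k → Fin 2, jointInput P x = 1 := by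
  have h := congrArg (Polynomial.eval 1) (sumPoly_eq_sum_jointInput hP)
  simpa [sumPoly, Polynomial.eval_prod, Polynomial.eval_finsetSum] using h.symm

theorem outputLaw_none {k : ℕ} (δ : ℝ) {P : Fin k → Fin 2 → ℝ} (hP : P ∈ inputLaws k (Fin 2)) :
    outputLaw (adderErasure δ k) P none = δ := by
  simp only [outputLaw, adderErasure]
  rw [← Finset.sum_mul, sum_jointInput hP, one_mul]

theorem outputLaw_some {k : ℕ} (δ : ℝ) {P : Fin k → Fin 2 → ℝ} (hP : P ∈ inputLaws k (Fin 2))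
    (j : Fin (k + 1)) :
    outputLaw (adderErasure δ k) P (some j)
      = (1 - δ) * (sumPoly (fun i => P i 1) Finset.univ).coeff j := by
  rw [coeff_sumPoly_eq hP, Finset.mul_sum]
  refine Finset.sum_congr rfl fun x _ => ?_
  simp only [adderErasure]
  split_ifs <;> ring

/-- The information density takes the value `0` on erasures and `-log f (∑ x)` otherwise, where `f`
is the law of the sum of the inputs. -/
theorem expect_comp_infoDensity {k : ℕ} (δ : ℝ) {P : Fin k → Fin 2 → ℝ}
    (hP : P ∈ inputLaws k (Fin 2)) (φ : ℝ → ℝ) :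
    expect (adderErasure δ k) P (fun x y => φ (infoDensity (adderErasure δ k) P x y))
      = δ * φ 0 + (1 - δ) * ∑ j ∈ Finset.range (k + 1),
        (sumPoly (fun i => P i 1) Finset.univ).coeff j
          * φ (-Real.log ((sumPoly (fun i => P i 1) Finset.univ).coeff j)) := by
  have h0 : Real.log (δ / δ) = 0 := by
    -- without erasures the quotient is `0 / 0 = 0`, and `log 0 = 0`; its weight `δ` vanishes
    rcases eq_or_ne δ 0 with h | h
    · simp [h]
    · simp [div_self h]
  have key : ∀ x : Fin k → Fin 2,
      ∑ y, jointInput P x * adderErasure δ k x y * φ (infoDensity (adderErasure δ k) P x y)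
      = jointInput P x * (δ * φ 0) + (1 - δ) * (jointInput P x *
        φ (-Real.log ((sumPoly (fun i => P i 1) Finset.univ).coeff (∑ i, (x i : ℕ))))) := by
    intro x
    rw [Fintype.sum_option]
    congr 1
    · simp only [infoDensity, outputLaw_none δ hP]
      simp only [adderErasure, h0]
      ring
    · rw [Finset.sum_eq_single_of_mem (⟨∑ i, (x i : ℕ), sum_val_lt x⟩ : Fin (k + 1))
        (Finset.mem_univ _)]
      · simp only [infoDensity, outputLaw_some δ hP]
        simp only [adderErasure, if_true]
        rcases eq_or_ne (1 - δ) 0 with h | h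
        · simp [h]
        · rw [div_mul_cancel_left₀ h, Real.log_inv]
          ring
      · intro b _ hb
        have : ¬ ∑ i, (x i : ℕ) = (b : ℕ) := fun hh => hb (Fin.ext hh.symm)
        simp [adderErasure, this]
  simp only [expect, key]
  rw [Finset.sum_add_distrib, ← Finset.sum_mul, sum_jointInput hP, one_mul, ← Finset.mul_sum]
  rw [sum_jointInput_mul hP
    (fun j => φ (-Real.log ((sumPoly (fun i => P i 1) Finset.univ).coeff j)))]

theorem mutualInfo_adderErasure {k : ℕ} (δ : ℝ) {P : Fin k → Fin 2 → ℝ}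
    (hP : P ∈ inputLaws k (Fin 2)) :
    mutualInfo (adderErasure δ k) P = (1 - δ) * sumEntropy (fun i => P i 1) := by
  have h := expect_comp_infoDensity δ hP (fun t => t)
  simp only [mutualInfo, sumEntropy, Fintype.card_fin, Real.negMulLog]
  refine h.trans ?_
  rw [mul_zero, zero_add]
  congr 1
  exact Finset.sum_congr rfl fun j _ => by ring

/-- The information density has mean square deviation `mutualInfo ^ 2` on erasures. -/
theorem dispersion_adderErasure {k : ℕ} (δ : ℝ) {P : Fin k → Fin 2 → ℝ}
    (hP : P ∈ inputLaws k (Fin 2)) :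
    dispersion (adderErasure δ k) P = δ * mutualInfo (adderErasure δ k) P ^ 2 +
      (1 - δ) * ∑ j ∈ Finset.range (k + 1), (sumPoly (fun i => P i 1) Finset.univ).coeff j *
        (-Real.log ((sumPoly (fun i => P i 1) Finset.univ).coeff j)
          - mutualInfo (adderErasure δ k) P) ^ 2 := by
  have h := expect_comp_infoDensity δ hP (fun t => (t - mutualInfo (adderErasure δ k) P) ^ 2)
  rw [dispersion, h]
  ring

theorem equiprobable_mem_inputLaws (k : ℕ) : equiprobable k ∈ inputLaws k (Fin 2) := by
  intro i
  refine ⟨fun b => ?_, ?_⟩ <;> norm_num [equiprobable]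

end RAC

/-! ### Averaging the parameters increases the entropy -/

section EntropyMaximization

open Polynomial Finset

variable {ι : Type*}

theorem coeff_bernoulli_mul_zero (p : ℝ) (F : ℝ[X]) :
    ((C (1 - p) + C p * X) * F).coeff 0 = (1 - p) * F.coeff 0 := by
  simp [mul_coeff_zero]

theorem coeff_bernoulli_mul_succ (p : ℝ) (F : ℝ[X]) (j : ℕ) :
    ((C (1 - p) + C p * X) * F).coeff (j + 1) = (1 - p) * F.coeff (j + 1) + p * F.coeff j := by
  rw [add_mul, coeff_add, coeff_C_mul, mul_assoc, coeff_C_mul, coeff_X_mul]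

/-- The law of a sum of independent nondegenerate Bernoulli variables is positive exactly on its
range and strictly log-concave there. -/
theorem sumPoly_strict_logConcave [DecidableEq ι] {p : ι → ℝ} {A : Finset ι}
    (hp : ∀ i ∈ A, p i ∈ Set.Ioo (0 : ℝ) 1) :
    (∀ j ≤ #A, 0 < (sumPoly p A).coeff j) ∧ (∀ j, #A < j → (sumPoly p A).coeff j = 0) ∧
      ∀ j, j + 1 ≤ #A → (sumPoly p A).coeff j * (sumPoly p A).coeff (j + 2)
        < (sumPoly p A).coeff (j + 1) ^ 2 := by
  induction A using Finset.induction_on with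
  | empty =>
    simp only [sumPoly, prod_empty, card_empty, coeff_one]
    refine ⟨fun j hj => ?_, fun j hj => ?_, fun j hj => ?_⟩
    · have : j = 0 := by omega
      simp [this]
    · rw [if_neg (by omega)]
    · omega
  | insert i A hi ih =>
    obtain ⟨h1, h2, h3⟩ := ih fun i hiA => hp i (mem_insert_of_mem hiA)
    obtain ⟨hp0, hp1⟩ := hp i (mem_insert_self _ _)
    have hq : 0 < 1 - p i := by linarith
    have hF : sumPoly p (insert i A) = (C (1 - p i) + C (p i) * X) * sumPoly p A := by
      simp only [sumPoly, prod_insert hi]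
    rw [hF, card_insert_of_notMem hi]
    set a := (sumPoly p A).coeff with ha
    set q := 1 - p i
    have hnn : ∀ j, 0 ≤ a j := fun j => by
      rcases le_or_gt j (#A) with h | h
      · exact (h1 j h).le
      · rw [h2 j h]
    have hlc : ∀ j, a j * a (j + 2) ≤ a (j + 1) ^ 2 := fun j => by
      rcases le_or_gt (j + 1) (#A) with h | h
      · exact (h3 j h).le
      · rw [h2 (j + 2) (by omega), mul_zero]; positivity
    have hlc' : ∀ j, a j * a (j + 3) ≤ a (j + 1) * a (j + 2) := fun j => by
      rcases le_or_gt (j + 2) (#A) with h | h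
      · have e1 := hlc j
        have e2 := hlc (j + 1)
        have p1 := h1 (j + 1) (by omega)
        have p2 := h1 (j + 2) (by omega)
        refine le_of_mul_le_mul_right ?_ (mul_pos p1 p2)
        calc a j * a (j + 3) * (a (j + 1) * a (j + 2))
            = (a j * a (j + 2)) * (a (j + 1) * a (j + 3)) := by ring
          _ ≤ a (j + 1) ^ 2 * a (j + 2) ^ 2 :=
            mul_le_mul e1 e2 (mul_nonneg (hnn _) (hnn _)) (by positivity)
          _ = _ := by ring
      · rw [h2 (j + 3) (by omega), mul_zero]
        exact mul_nonneg (hnn _) (hnn _)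
    refine ⟨fun j hj => ?_, fun j hj => ?_, fun j hj => ?_⟩
    · cases j with
      | zero => rw [coeff_bernoulli_mul_zero]; exact mul_pos hq (h1 0 (by omega))
      | succ j =>
        rw [coeff_bernoulli_mul_succ]
        have := h1 j (by omega)
        have := hnn (j + 1)
        positivity
    · cases j with
      | zero => omega
      | succ j =>
        rw [coeff_bernoulli_mul_succ]
        change q * a (j + 1) + p i * a j = 0
        rw [h2 (j + 1) (by omega), h2 j (by omega)]
        ring
    · rw [coeff_bernoulli_mul_succ _ _ j, coeff_bernoulli_mul_succ _ _ (j + 1)]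
      change _ * (q * a (j + 2) + p i * a (j + 1)) < (q * a (j + 1) + p i * a j) ^ 2
      rcases Nat.lt_or_ge (#A) (j + 1) with hlt | hle
      · rw [h2 (j + 2) (by omega), h2 (j + 1) (by omega)]
        have := h1 j (by omega)
        have : 0 < (q * 0 + p i * a j) ^ 2 := by rw [mul_zero, zero_add]; positivity
        simpa using this
      · have e1 := mul_lt_mul_of_pos_left (h3 j hle) (pow_pos hq 2)
        cases j with
        | zero =>
          rw [coeff_bernoulli_mul_zero]
          change q * a 0 * _ < _
          have := mul_pos (mul_pos hp0 hq) (mul_pos (h1 0 (by omega)) (h1 1 hle))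
          have := sq_nonneg (p i * a 0)
          simp only [zero_add] at e1 ⊢
          linear_combination e1 + 1 * this + 1 * ‹0 < p i * q * (a 0 * a 1)›
        | succ j =>
          rw [coeff_bernoulli_mul_succ]
          change (q * a (j + 1) + p i * a j) * _ < _
          have e2 := mul_le_mul_of_nonneg_left (hlc j) (pow_pos hp0 2).le
          have e3 := mul_le_mul_of_nonneg_left (hlc' j) (mul_pos hp0 hq).le
          linear_combination e1 + e2 + e3

/-- The product rule for coefficientwise derivatives of families of polynomials. -/
theorem hasDerivAt_coeff_mul {F G : ℝ → ℝ[X]} {F' G' : ℝ[X]} {s : ℝ}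
    (hF : ∀ j, HasDerivAt (fun t => (F t).coeff j) (F'.coeff j) s)
    (hG : ∀ j, HasDerivAt (fun t => (G t).coeff j) (G'.coeff j) s) (j : ℕ) :
    HasDerivAt (fun t => (F t * G t).coeff j) ((F' * G s + F s * G').coeff j) s := by
  simp only [coeff_add, coeff_mul]
  rw [← sum_add_distrib]
  exact HasDerivAt.fun_sum fun x _ => (hF x.1).mul (hG x.2)

/-- Moving the parameters `p i` with velocities `v i` moves the law of the sum by
`∑ v i (X - 1) R i`, where `R i` is the law of the sum without the `i`-th variable. -/
theorem hasDerivAt_coeff_sumPoly [DecidableEq ι] {p : ℝ → ι → ℝ} {v : ι → ℝ} {s : ℝ}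
    (hp : ∀ i, HasDerivAt (fun t => p t i) (v i) s) (A : Finset ι) (j : ℕ) :
    HasDerivAt (fun t => (sumPoly (p t) A).coeff j)
      ((∑ i ∈ A, C (v i) * ((X - 1) * sumPoly (p s) (A.erase i))).coeff j) s := by
  induction A using Finset.induction_on generalizing j with
  | empty => simpa [sumPoly] using hasDerivAt_const s ((1 : ℝ[X]).coeff j)
  | insert i A hi ih =>
    have hF : ∀ t, sumPoly (p t) (insert i A)
        = (C (1 - p t i) + C (p t i) * X) * sumPoly (p t) A := fun t => by
      simp only [sumPoly, prod_insert hi]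
    have hlin : ∀ j, HasDerivAt (fun t => (C (1 - p t i) + C (p t i) * X).coeff j)
        ((C (v i) * (X - 1)).coeff j) s := by
      intro j
      have h := ((hp i).const_sub 1).mul_const ((1 : ℝ[X]).coeff j)
      have h' := (hp i).mul_const ((X : ℝ[X]).coeff j)
      have h'' := h.add h'
      refine (h''.congr_deriv ?_).congr_of_eventuallyEq (Filter.Eventually.of_forall fun t => ?_)
      · simp only [coeff_C_mul, coeff_sub]; ring
      · change (C (1 - p t i) + C (p t i) * X).coeff j
          = (1 - p t i) * (1 : ℝ[X]).coeff j + p t i * (X : ℝ[X]).coeff j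
        rw [coeff_add, coeff_C_mul, ← coeff_C_mul (1 : ℝ[X]), mul_one]
    simp only [hF]
    refine (hasDerivAt_coeff_mul hlin ih j).congr_deriv ?_
    congr 1
    rw [sum_insert hi, erase_insert hi, mul_sum]
    congr 1
    · ring
    · refine sum_congr rfl fun l hl => ?_
      have hli : i ≠ l := fun h => hi (h ▸ hl)
      have : sumPoly (p s) ((insert i A).erase l)
          = (C (1 - p s i) + C (p s i) * X) * sumPoly (p s) (A.erase l) := by
        rw [erase_insert_of_ne hli]
        simp only [sumPoly]
        rw [prod_insert (fun h => hi (mem_of_mem_erase h))]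
      rw [this]
      ring

/-- Summation by parts. -/
theorem sum_mul_coeff_X_sub_one_mul (g : ℕ → ℝ) (R : ℝ[X]) (n : ℕ) :
    ∑ j ∈ range (n + 1), g j * ((X - 1) * R).coeff j
      = ∑ j ∈ range n, R.coeff j * (g (j + 1) - g j) - g n * R.coeff n := by
  induction n with
  | zero => simp [sub_mul]
  | succ n ih =>
    rw [sum_range_succ, ih, sum_range_succ, sub_mul, coeff_sub, coeff_X_mul, one_mul]
    ring

theorem coeff_sumPoly_of_card_lt {p : ι → ℝ} {A : Finset ι} {j : ℕ} (hj : #A < j) :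
    (sumPoly p A).coeff j = 0 := by
  refine coeff_eq_zero_of_natDegree_lt (lt_of_le_of_lt ?_ hj)
  refine (natDegree_prod_le _ _).trans ((sum_le_card_nsmul _ _ 1 fun i _ => ?_).trans (by simp))
  rw [add_comm]
  exact natDegree_linear_le

variable [Fintype ι] [DecidableEq ι]

/-- The partial derivative of `sumEntropy` in the `i`-th parameter, as a sum against the law of the
sum of the other variables. -/
noncomputable def entropyGrad (p : ι → ℝ) (i : ι) : ℝ :=
  ∑ j ∈ range (Fintype.card ι), (sumPoly p (univ.erase i)).coeff j *
    (Real.log ((sumPoly p univ).coeff j) - Real.log ((sumPoly p univ).coeff (j + 1)))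

theorem continuous_sumEntropy_comp {p : ℝ → ι → ℝ} {v : ι → ℝ}
    (hp : ∀ s i, HasDerivAt (fun t => p t i) (v i) s) : Continuous fun t => sumEntropy (p t) := by
  refine continuous_finsetSum _ fun j _ => Real.continuous_negMulLog.comp ?_
  exact continuous_iff_continuousAt.2 fun s =>
    (hasDerivAt_coeff_sumPoly (hp s) univ j).continuousAt

theorem hasDerivAt_sumEntropy {p : ℝ → ι → ℝ} {v : ι → ℝ} {s : ℝ}
    (hp : ∀ i, HasDerivAt (fun t => p t i) (v i) s) (h01 : ∀ i, p s i ∈ Set.Ioo (0 : ℝ) 1) :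
    HasDerivAt (fun t => sumEntropy (p t)) (∑ i, v i * entropyGrad (p s) i) s := by
  have hpos := (sumPoly_strict_logConcave (A := univ) fun i _ => h01 i).1
  have hd := HasDerivAt.fun_sum (u := range (Fintype.card ι + 1)) fun j hj =>
    (Real.hasDerivAt_negMulLog
      (hpos j (by simpa [Nat.lt_succ_iff] using hj)).ne').comp s (hasDerivAt_coeff_sumPoly hp univ j)
  refine hd.congr_deriv ?_
  simp only [finsetSum_coeff, coeff_C_mul, mul_sum]
  rw [sum_comm]
  refine sum_congr rfl fun i _ => ?_
  have h := sum_mul_coeff_X_sub_one_mul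
    (fun j => -Real.log ((sumPoly (p s) univ).coeff j) - 1) (sumPoly (p s) (univ.erase i))
    (Fintype.card ι)
  have hz : (sumPoly (p s) (univ.erase i)).coeff (Fintype.card ι) = 0 := by
    refine coeff_sumPoly_of_card_lt ?_
    rw [card_erase_of_mem (mem_univ _), card_univ]
    exact Nat.sub_lt (Fintype.card_pos_iff.2 ⟨i⟩) one_pos
  rw [hz, mul_zero, sub_zero] at h
  simp only [entropyGrad]
  calc _ = v i * ∑ j ∈ range (Fintype.card ι + 1),
        (-Real.log ((sumPoly (p s) univ).coeff j) - 1) *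
          ((X - 1) * sumPoly (p s) (univ.erase i)).coeff j := by
        rw [mul_sum]; exact sum_congr rfl fun j _ => by ring
    _ = _ := by
        rw [h]; congr 1; exact sum_congr rfl fun j _ => by ring

/-- The entropy increases when two parameters are moved towards each other. By summation by parts
the difference of the partial derivatives is an average of the second differences of `-log f`. -/
theorem sub_mul_entropyGrad_sub_neg {p : ι → ℝ} (h01 : ∀ i, p i ∈ Set.Ioo (0 : ℝ) 1) {i l : ι}
    (hil : p i ≠ p l) : (p i - p l) * (entropyGrad p i - entropyGrad p l) < 0 := by
  have hne : i ≠ l := fun h => hil (by rw [h])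
  obtain ⟨hpos, -, hlc⟩ := sumPoly_strict_logConcave (A := univ) fun i _ => h01 i
  rw [card_univ] at hpos hlc
  set f := (sumPoly p univ).coeff with hf
  set T := sumPoly p ((univ.erase i).erase l) with hT
  obtain ⟨hTpos, -, -⟩ := sumPoly_strict_logConcave (A := (univ.erase i).erase l) fun i _ => h01 i
  have hli : l ∈ univ.erase i := mem_erase.2 ⟨hne.symm, mem_univ _⟩
  obtain ⟨m, hm⟩ : ∃ m, Fintype.card ι = m + 2 := by
    have : 1 < Fintype.card ι := Fintype.one_lt_card_iff.2 ⟨i, l, hne⟩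
    exact ⟨Fintype.card ι - 2, by omega⟩
  have hcT : #((univ.erase i).erase l) = m := by
    rw [card_erase_of_mem hli, card_erase_of_mem (mem_univ _), card_univ, hm]
    rfl
  have hRi : sumPoly p (univ.erase i) = (C (1 - p l) + C (p l) * X) * T := by
    simp only [sumPoly, hT]
    rw [mul_prod_erase _ (fun i => C (1 - p i) + C (p i) * X) hli]
  have hRl : sumPoly p (univ.erase l) = (C (1 - p i) + C (p i) * X) * T := by
    simp only [sumPoly, hT]
    rw [erase_right_comm,
      mul_prod_erase _ (fun i => C (1 - p i) + C (p i) * X) (mem_erase.2 ⟨hne, mem_univ _⟩)]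
  have hdiff : ∀ j, (sumPoly p (univ.erase i)).coeff j - (sumPoly p (univ.erase l)).coeff j
      = (p l - p i) * ((X - 1) * T).coeff j := by
    intro j
    rw [← coeff_sub, ← coeff_C_mul, hRi, hRl]
    congr 1
    simp only [C_sub]
    ring
  have hparts := sum_mul_coeff_X_sub_one_mul
    (fun j => Real.log (f j) - Real.log (f (j + 1))) T (m + 1)
  rw [coeff_sumPoly_of_card_lt (by omega), mul_zero, sub_zero] at hparts
  have hS : 0 < ∑ j ∈ range (m + 1), T.coeff j *
      (Real.log (f (j + 1)) - Real.log (f (j + 1 + 1)) - (Real.log (f j) - Real.log (f (j + 1)))) := by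
    refine sum_pos (fun j hj => ?_) (by simp)
    have hj' := mem_range.1 hj
    have f0 := hpos j (by omega)
    have f1 := hpos (j + 1) (by omega)
    have f2 := hpos (j + 2) (by omega)
    refine mul_pos (hTpos j (by omega)) ?_
    have := Real.log_lt_log (mul_pos f0 f2) (hlc j (by omega))
    rw [Real.log_mul f0.ne' f2.ne', Real.log_pow] at this
    push_cast at this
    change 0 < Real.log (f (j + 1)) - Real.log (f (j + 2)) - (Real.log (f j) - Real.log (f (j + 1)))
    linarith
  have hgrad : entropyGrad p i - entropyGrad p l = (p l - p i) * ∑ j ∈ range (m + 1), T.coeff j *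
      (Real.log (f (j + 1)) - Real.log (f (j + 1 + 1))
        - (Real.log (f j) - Real.log (f (j + 1)))) := by
    simp only [entropyGrad]
    rw [← sum_sub_distrib, ← hparts, mul_sum, hm]
    refine sum_congr rfl fun j _ => ?_
    rw [← sub_mul, hdiff]
    ring
  rw [hgrad]
  have : 0 < (p i - p l) ^ 2 := by
    have := sub_ne_zero.2 hil
    positivity
  have := mul_pos this hS
  linear_combination this

/-- Averaging the parameters strictly increases the entropy. -/
theorem sumEntropy_lt_average {p : ι → ℝ} (hp : ∀ i, p i ∈ Set.Icc (0 : ℝ) 1) {i₀ l₀ : ι}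
    (hne : p i₀ ≠ p l₀) :
    ∃ c ∈ Set.Icc (0 : ℝ) 1, sumEntropy p < sumEntropy (fun _ : ι => c) := by
  set n : ℝ := (Fintype.card ι : ℝ) with hn
  have hn0 : 0 < n := by
    rw [hn]; exact_mod_cast Fintype.card_pos_iff.2 ⟨i₀⟩
  set c : ℝ := (∑ i, p i) / n with hc
  have hsum : ∑ i, p i = n * c := by rw [hc]; field_simp
  -- the mean is nondegenerate because the parameters are not all equal
  have hc0 : 0 < c := by
    refine div_pos ?_ hn0
    rcases eq_or_ne (p i₀) 0 with h | h
    · exact sum_pos' (fun i _ => (hp i).1) ⟨l₀, mem_univ _, lt_of_le_of_ne (hp l₀).1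
        (fun h' => hne (by rw [h, ← h']))⟩
    · exact sum_pos' (fun i _ => (hp i).1) ⟨i₀, mem_univ _, lt_of_le_of_ne (hp i₀).1 h.symm⟩
  have hc1 : c < 1 := by
    have : 0 < ∑ i, (1 - p i) := by
      rcases eq_or_ne (p i₀) 1 with h | h
      · exact sum_pos' (fun i _ => by linarith [(hp i).2]) ⟨l₀, mem_univ _, by
          have := lt_of_le_of_ne (hp l₀).2 (fun h' => hne (by rw [h, ← h'])); linarith⟩
      · exact sum_pos' (fun i _ => by linarith [(hp i).2]) ⟨i₀, mem_univ _, by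
          have := lt_of_le_of_ne (hp i₀).2 h; linarith⟩
    rw [sum_sub_distrib, hsum, sum_const, card_univ, nsmul_eq_mul, mul_one, ← hn] at this
    nlinarith
  refine ⟨c, ⟨hc0.le, hc1.le⟩, ?_⟩
  set P : ℝ → ι → ℝ := fun s i => c + s * (p i - c) with hP
  have hder : ∀ s i, HasDerivAt (fun t => P t i) (p i - c) s := fun s i => by
    simpa only [hP, id_eq, one_mul] using ((hasDerivAt_id s).mul_const (p i - c)).const_add c
  have hanti : StrictAntiOn (fun s => sumEntropy (P s)) (Set.Icc 0 1) := by
    refine strictAntiOn_of_deriv_neg (convex_Icc 0 1)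
      (continuous_sumEntropy_comp hder).continuousOn fun s hs => ?_
    rw [interior_Icc] at hs
    have h01 : ∀ i, P s i ∈ Set.Ioo (0 : ℝ) 1 := fun i => by
      have h1 := mul_nonneg hs.1.le (hp i).1
      have h2 := mul_nonneg hs.1.le (sub_nonneg.2 (hp i).2)
      have h3 := mul_pos (sub_pos.2 hs.2) hc0
      have h4 := mul_pos (sub_pos.2 hs.2) (sub_pos.2 hc1)
      constructor <;> simp only [hP] <;> nlinarith
    rw [(hasDerivAt_sumEntropy (hder s) h01).deriv]
    set G := entropyGrad (P s)
    -- symmetrize the derivative into a double sum over pairs of parameters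
    have hsym : 2 * n * ∑ i, (p i - c) * G i = ∑ i, ∑ l, (p i - p l) * (G i - G l) := by
      have e : ∀ i, ∑ l, (p i - p l) * (G i - G l)
          = n * (p i * G i) - p i * ∑ l, G l - G i * (n * c) + ∑ l, p l * G l := fun i => by
        have : ∀ l, (p i - p l) * (G i - G l)
            = p i * G i - p i * G l - G i * p l + p l * G l := fun l => by ring
        simp only [this, sum_add_distrib, sum_sub_distrib, ← mul_sum, hsum, sum_const, card_univ,
          nsmul_eq_mul, ← hn]
        ring
      have e' : ∑ i, (p i - c) * G i = ∑ i, p i * G i - c * ∑ i, G i := by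
        rw [mul_sum, ← sum_sub_distrib]
        exact sum_congr rfl fun i _ => sub_mul _ _ _
      rw [e', sum_congr rfl fun i _ => e i]
      simp only [sum_add_distrib, sum_sub_distrib, ← mul_sum, ← sum_mul, hsum, sum_const,
        card_univ, nsmul_eq_mul, ← hn]
      ring
    have hterm : ∀ i l, (p i - p l) * (G i - G l) ≤ 0 ∧
        (p i ≠ p l → (p i - p l) * (G i - G l) < 0) := fun i l => by
      have hstrict : p i ≠ p l → (p i - p l) * (G i - G l) < 0 := fun h => by
        have hPd : P s i - P s l = s * (p i - p l) := by simp only [hP]; ring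
        have := sub_mul_entropyGrad_sub_neg h01 (i := i) (l := l) (by
          rw [← sub_ne_zero, hPd]
          exact mul_ne_zero hs.1.ne' (sub_ne_zero.2 h))
        rw [hPd, mul_assoc] at this
        exact (pos_iff_neg_of_mul_neg this).1 hs.1
      refine ⟨?_, hstrict⟩
      rcases eq_or_ne (p i) (p l) with h | h
      · rw [h]; simp
      · exact (hstrict h).le
    have hneg : ∑ i, ∑ l, (p i - p l) * (G i - G l) < 0 :=
      sum_neg' (fun i _ => sum_nonpos fun l _ => (hterm i l).1) ⟨i₀, mem_univ _,
        sum_neg' (fun l _ => (hterm i₀ l).1) ⟨l₀, mem_univ _, (hterm i₀ l₀).2 hne⟩⟩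
    rw [← hsym] at hneg
    exact (pos_iff_neg_of_mul_neg hneg).1 (by positivity)
  have h := hanti (Set.left_mem_Icc.2 zero_le_one) (Set.right_mem_Icc.2 zero_le_one) one_pos
  simpa [hP] using h

end EntropyMaximization

/-! ### The entropy of binomial laws -/

section BinomialEntropy

open Polynomial Finset

theorem coeff_bernoulli_pow (p : ℝ) (m j : ℕ) :
    ((C (1 - p) + C p * X) ^ m).coeff j = m.choose j * p ^ j * (1 - p) ^ (m - j) := by
  have h : ∀ i ∈ range (m + 1), ((C p * X) ^ i * C (1 - p) ^ (m - i) * (m.choose i : ℝ[X])).coeff j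
      = if j = i then m.choose j * p ^ j * (1 - p) ^ (m - j) else 0 := by
    intro i _
    have : (C p * X) ^ i * C (1 - p) ^ (m - i) * (m.choose i : ℝ[X])
        = C (m.choose i * p ^ i * (1 - p) ^ (m - i)) * X ^ i := by
      simp only [C_mul, C_pow, mul_pow, map_natCast]
      ring
    rw [this, coeff_C_mul_X_pow]
    split_ifs with h
    · rw [h]
    · rfl
  rw [add_comm, add_pow, finsetSum_coeff, sum_congr rfl h, sum_ite_eq]
  split_ifs with hj
  · rfl
  · rw [Nat.choose_eq_zero_of_lt (by simpa using hj)]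
    simp

theorem sum_coeff_bernoulli_pow (p : ℝ) (m : ℕ) :
    ∑ j ∈ range (m + 1), ((C (1 - p) + C p * X) ^ m).coeff j = 1 := by
  simp only [coeff_bernoulli_pow]
  have := add_pow p (1 - p) m
  rw [add_sub_cancel, one_pow] at this
  exact (sum_congr rfl fun j _ => by ring).trans this.symm

theorem sumPoly_const {ι : Type*} (p : ℝ) (A : Finset ι) :
    sumPoly (fun _ : ι => p) A = (C (1 - p) + C p * X) ^ #A := by
  simp [sumPoly]

/-- The derivative in `p` of the entropy of the binomial law with `m + 1` trials and success
probability `p`, divided by `m + 1`. -/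
noncomputable def binomialEntropySlope (m : ℕ) (p : ℝ) : ℝ :=
  Real.log (1 - p) - Real.log p + ∑ j ∈ range (m + 1),
    (Real.log (j + 1) - Real.log ((m : ℝ) + 1 - j)) * ((C (1 - p) + C p * X) ^ m).coeff j

theorem entropyGrad_const {ι : Type*} [Fintype ι] [DecidableEq ι] {m : ℕ}
    (hm : Fintype.card ι = m + 1) {p : ℝ} (hp : p ∈ Set.Ioo (0 : ℝ) 1) (i : ι) :
    entropyGrad (fun _ => p) i = binomialEntropySlope m p := by
  have hcard : #(univ.erase i) = m := by
    rw [card_erase_of_mem (mem_univ _), card_univ, hm]; rfl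
  have hp0 := hp.1
  have hq : 0 < 1 - p := sub_pos.2 hp.2
  simp only [entropyGrad, sumPoly_const, hcard, card_univ, hm, binomialEntropySlope]
  have hone : Real.log (1 - p) - Real.log p = ∑ j ∈ range (m + 1),
      ((C (1 - p) + C p * X) ^ m).coeff j * (Real.log (1 - p) - Real.log p) := by
    rw [← sum_mul, sum_coeff_bernoulli_pow, one_mul]
  rw [hone, ← sum_add_distrib]
  refine sum_congr rfl fun j hj => ?_
  have hj' : j < m + 1 := mem_range.1 hj
  have hjr : (0 : ℝ) < (m : ℝ) + 1 - j := by
    have : (j : ℝ) < (m : ℝ) + 1 := by exact_mod_cast hj'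
    linarith
  have hf : ∀ l ≤ m + 1, 0 < ((C (1 - p) + C p * X) ^ (m + 1)).coeff l := fun l hl => by
    rw [coeff_bernoulli_pow]
    have : (0 : ℝ) < (m + 1).choose l := by exact_mod_cast Nat.choose_pos hl
    positivity
  have hrat : ((C (1 - p) + C p * X) ^ (m + 1)).coeff j * ((m : ℝ) + 1 - j) * p
      = ((C (1 - p) + C p * X) ^ (m + 1)).coeff (j + 1) * (j + 1) * (1 - p) := by
    have hc : ((m + 1).choose (j + 1) : ℝ) * (j + 1) = (m + 1).choose j * ((m : ℝ) + 1 - j) := by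
      have h := Nat.choose_succ_right_eq (m + 1) j
      have h' := congrArg (Nat.cast : ℕ → ℝ) h
      rw [Nat.cast_mul, Nat.cast_mul, Nat.cast_sub hj'.le] at h'
      push_cast at h'
      exact h'
    rw [coeff_bernoulli_pow, coeff_bernoulli_pow,
      show m + 1 - j = m + 1 - (j + 1) + 1 by omega, pow_succ, pow_succ]
    linear_combination -(p ^ j * p * (1 - p) ^ (m + 1 - (j + 1)) * (1 - p)) * hc
  have hlog := congrArg Real.log hrat
  have h0 := hf j hj'.le
  have h1 := hf (j + 1) hj'
  rw [Real.log_mul (by positivity) hp0.ne', Real.log_mul h0.ne' hjr.ne',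
    Real.log_mul (by positivity) hq.ne', Real.log_mul h1.ne' (by positivity)] at hlog
  linear_combination ((C (1 - p) + C p * X) ^ m).coeff j * hlog

/-- For a binomial variable `J` with `m` trials, `(m + 1) E[1 / (J + 1)] = (1 - (1 - p) ^ (m + 1)) / p`,
by the absorption identity for binomial coefficients. -/
theorem sum_coeff_bernoulli_pow_div_lt {p : ℝ} (hp : p ∈ Set.Ioo (0 : ℝ) 1) (m : ℕ) :
    (m + 1) * ∑ j ∈ range (m + 1), ((C (1 - p) + C p * X) ^ m).coeff j * (1 / ((j : ℝ) + 1))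
      < 1 / p := by
  have hp0 := hp.1
  have hq : 0 < 1 - p := sub_pos.2 hp.2
  rw [lt_div_iff₀ hp0, mul_sum, sum_mul]
  have h := sum_coeff_bernoulli_pow p (m + 1)
  rw [sum_range_succ'] at h
  have h0 : 0 < ((C (1 - p) + C p * X) ^ (m + 1)).coeff 0 := by
    rw [coeff_bernoulli_pow]; simp only [Nat.choose_zero_right, Nat.cast_one]; positivity
  refine lt_of_eq_of_lt (sum_congr rfl fun j _ => ?_) (show
    ∑ j ∈ range (m + 1), ((C (1 - p) + C p * X) ^ (m + 1)).coeff (j + 1) < 1 by linarith)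
  rw [coeff_bernoulli_pow, coeff_bernoulli_pow, Nat.add_sub_add_right]
  have hc : ((m : ℝ) + 1) * m.choose j = (m + 1).choose (j + 1) * ((j : ℝ) + 1) := by
    exact_mod_cast Nat.add_one_mul_choose_eq m j
  have hj : (j : ℝ) + 1 ≠ 0 := by positivity
  field_simp
  linear_combination p ^ (j + 1) * hc

theorem coeff_bernoulli_pow_reflect {p : ℝ} {m j : ℕ} (hj : j ≤ m) :
    ((C (1 - p) + C p * X) ^ m).coeff (m - j)
      = ((C (1 - (1 - p)) + C (1 - p) * X) ^ m).coeff j := by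
  rw [coeff_bernoulli_pow, coeff_bernoulli_pow, Nat.choose_symm hj, Nat.sub_sub_self hj,
    sub_sub_cancel]
  ring

/-- The bound `sum_coeff_bernoulli_pow_div_lt` for the number of failures. -/
theorem sum_coeff_bernoulli_pow_div_lt' {p : ℝ} (hp : p ∈ Set.Ioo (0 : ℝ) 1) (m : ℕ) :
    (m + 1) * ∑ j ∈ range (m + 1),
      ((C (1 - p) + C p * X) ^ m).coeff j * (1 / ((m : ℝ) + 1 - j)) < 1 / (1 - p) := by
  have h := sum_coeff_bernoulli_pow_div_lt (p := 1 - p) ⟨by linarith [hp.2], by linarith [hp.1]⟩ m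
  rw [← sum_range_reflect]
  refine lt_of_eq_of_lt ?_ h
  congr 1
  refine sum_congr rfl fun j hj => ?_
  have hj' : j ≤ m := Nat.lt_succ_iff.1 (mem_range.1 hj)
  rw [show m + 1 - 1 - j = m - j by omega, coeff_bernoulli_pow_reflect hj', Nat.cast_sub hj']
  congr 2
  ring

theorem hasDerivAt_coeff_bernoulli_pow (m j : ℕ) (s : ℝ) :
    HasDerivAt (fun t : ℝ => ((C (1 - t) + C t * X) ^ m).coeff j)
      ((m : ℝ) * ((X - 1) * (C (1 - s) + C s * X) ^ (m - 1)).coeff j) s := by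
  have h := hasDerivAt_coeff_sumPoly (ι := Fin m) (p := fun t _ => t) (v := fun _ => 1)
    (fun _ => hasDerivAt_id s) univ j
  simp only [sumPoly_const, card_univ, Fintype.card_fin, map_one, one_mul,
    card_erase_of_mem (mem_univ _), sum_const, nsmul_eq_mul, coeff_natCast_mul] at h
  exact h

/-- The slope is strictly decreasing: the derivative of the sum is `m` times an average of
`log ((J + 2) / (J + 1)) + log ((m + 1 - J) / (m - J)) ≤ 1 / (J + 1) + 1 / (m - J)`, hence smaller
than `1 / p + 1 / (1 - p)`. -/
theorem strictAntiOn_binomialEntropySlope (m : ℕ) :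
    StrictAntiOn (binomialEntropySlope m) (Set.Ioo 0 1) := by
  set h : ℕ → ℝ := fun j => Real.log (j + 1) - Real.log ((m : ℝ) + 1 - j) with hh
  have hder : ∀ s ∈ Set.Ioo (0 : ℝ) 1, HasDerivAt (binomialEntropySlope m)
      (-1 / (1 - s) - 1 / s + ∑ j ∈ range (m + 1), h j *
        (m * ((X - 1) * (C (1 - s) + C s * X) ^ (m - 1)).coeff j)) s := fun s hs => by
    have h1 : HasDerivAt (fun t : ℝ => Real.log (1 - t)) (-1 / (1 - s)) s :=
      ((hasDerivAt_id s).const_sub 1).log (sub_pos.2 hs.2).ne'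
    have h2 : HasDerivAt (fun t : ℝ => Real.log t) (1 / s) s := by
      simpa using Real.hasDerivAt_log hs.1.ne'
    exact (h1.sub h2).add (HasDerivAt.fun_sum fun j _ =>
      (hasDerivAt_coeff_bernoulli_pow m j s).const_mul (h j))
  refine strictAntiOn_of_deriv_neg (convex_Ioo 0 1)
    (fun s hs => (hder s hs).continuousAt.continuousWithinAt) fun s hs => ?_
  rw [interior_Ioo] at hs
  rw [(hder s hs).deriv]
  have hs0 := hs.1
  have hq : 0 < 1 - s := sub_pos.2 hs.2
  suffices hS : ∑ j ∈ range (m + 1), h j *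
      (m * ((X - 1) * (C (1 - s) + C s * X) ^ (m - 1)).coeff j) < 1 / s + 1 / (1 - s) by
    have : -1 / (1 - s) = -(1 / (1 - s)) := by ring
    linarith
  cases m with
  | zero =>
    have : 0 < 1 / s + 1 / (1 - s) := by positivity
    simpa using this
  | succ m =>
    have hparts := sum_mul_coeff_X_sub_one_mul h ((C (1 - s) + C s * X) ^ m) (m + 1)
    rw [coeff_bernoulli_pow s m (m + 1), Nat.choose_succ_self] at hparts
    have hle : ∀ j ∈ range (m + 1), ((C (1 - s) + C s * X) ^ m).coeff j * (h (j + 1) - h j)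
        ≤ ((C (1 - s) + C s * X) ^ m).coeff j * (1 / ((j : ℝ) + 1)) +
          ((C (1 - s) + C s * X) ^ m).coeff j * (1 / ((m : ℝ) + 1 - j)) := by
      intro j hj
      rw [← mul_add]
      refine mul_le_mul_of_nonneg_left ?_ (by rw [coeff_bernoulli_pow]; positivity)
      have hjr : (0 : ℝ) < (m : ℝ) + 1 - j := by
        have : (j : ℝ) < (m : ℝ) + 1 := by exact_mod_cast mem_range.1 hj
        linarith
      have hlog : ∀ x : ℝ, 0 < x → Real.log (x + 1) - Real.log x ≤ 1 / x := fun x hx => by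
        rw [← Real.log_div (by positivity) hx.ne']
        refine (Real.log_le_sub_one_of_pos (by positivity)).trans (le_of_eq ?_)
        field_simp
        ring
      have e1 := hlog (j + 1) (by positivity)
      have e2 := hlog ((m : ℝ) + 1 - j) hjr
      simp only [hh]
      push_cast
      rw [show (m : ℝ) + 1 + 1 - (j + 1) = (m : ℝ) + 1 - j by ring,
        show (m : ℝ) + 1 + 1 - j = (m : ℝ) + 1 - j + 1 by ring]
      linarith
    have hsum := sum_le_sum hle
    rw [sum_add_distrib] at hsum
    have b1 := sum_coeff_bernoulli_pow_div_lt hs m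
    have b2 := sum_coeff_bernoulli_pow_div_lt' hs m
    have hm : (0 : ℝ) < (m : ℝ) + 1 := by positivity
    have hsum' := mul_le_mul_of_nonneg_left hsum hm.le
    calc _ = ((m : ℝ) + 1) * ∑ j ∈ range (m + 1 + 1),
          h j * ((X - 1) * (C (1 - s) + C s * X) ^ m).coeff j := by
          rw [mul_sum]
          refine sum_congr rfl fun j _ => ?_
          push_cast
          ring
      _ < _ := by
          rw [hparts, Nat.cast_zero, zero_mul, zero_mul, mul_zero, sub_zero]
          linarith

theorem binomialEntropySlope_half (m : ℕ) : binomialEntropySlope m (1 / 2) = 0 := by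
  have hrefl : ∀ h : ℕ → ℝ, ∑ j ∈ range (m + 1),
      h (m - j) * ((C (1 - (1 / 2 : ℝ)) + C (1 / 2) * X) ^ m).coeff j
      = ∑ j ∈ range (m + 1), h j * ((C (1 - (1 / 2 : ℝ)) + C (1 / 2) * X) ^ m).coeff j := by
    intro h
    rw [← sum_range_reflect]
    refine sum_congr rfl fun j hj => ?_
    have hj' : j ≤ m := Nat.lt_succ_iff.1 (mem_range.1 hj)
    rw [show m + 1 - 1 - j = m - j by omega, coeff_bernoulli_pow_reflect hj', Nat.sub_sub_self hj']
    norm_num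
  have h1 := hrefl (fun j => Real.log (j + 1))
  simp only [binomialEntropySlope, sub_mul, sum_sub_distrib]
  rw [← h1]
  have : ∑ j ∈ range (m + 1), Real.log (((m - j : ℕ) : ℝ) + 1) *
      ((C (1 - (1 / 2 : ℝ)) + C (1 / 2) * X) ^ m).coeff j
      = ∑ j ∈ range (m + 1), Real.log ((m : ℝ) + 1 - j) *
      ((C (1 - (1 / 2 : ℝ)) + C (1 / 2) * X) ^ m).coeff j := by
    refine sum_congr rfl fun j hj => ?_
    rw [Nat.cast_sub (Nat.lt_succ_iff.1 (mem_range.1 hj))]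
    congr 2
    ring
  rw [this]
  norm_num

variable {ι : Type*} [Fintype ι] [DecidableEq ι]

/-- Among binomial laws, the entropy is maximal only for success probability `1 / 2`, the zero of
the slope. -/
theorem sumEntropy_const_lt [Nonempty ι] {c : ℝ} (hc : c ∈ Set.Icc (0 : ℝ) 1) (hne : c ≠ 1 / 2) :
    sumEntropy (fun _ : ι => c) < sumEntropy (fun _ : ι => (1 / 2 : ℝ)) := by
  obtain ⟨m, hm⟩ : ∃ m, Fintype.card ι = m + 1 :=
    ⟨Fintype.card ι - 1, by have := Fintype.card_pos (α := ι); omega⟩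
  have hcont : Continuous fun t : ℝ => sumEntropy (fun _ : ι => t) :=
    continuous_sumEntropy_comp (p := fun t _ => t) (v := fun _ => 1) fun s _ => hasDerivAt_id s
  have hder : ∀ s ∈ Set.Ioo (0 : ℝ) 1, deriv (fun t : ℝ => sumEntropy (fun _ : ι => t)) s
      = (m + 1) * binomialEntropySlope m s := fun s hs => by
    rw [(hasDerivAt_sumEntropy (p := fun t (_ : ι) => t) (v := fun _ => 1)
      (fun _ => hasDerivAt_id s) fun _ => hs).deriv]
    simp only [entropyGrad_const hm hs, one_mul, sum_const, card_univ, hm, nsmul_eq_mul]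
    push_cast
    ring
  have hm0 : (0 : ℝ) < (m : ℝ) + 1 := by positivity
  have hhalf : (1 / 2 : ℝ) ∈ Set.Ioo (0 : ℝ) 1 := by constructor <;> norm_num
  rcases lt_or_gt_of_ne hne with h | h
  · have hmono : StrictMonoOn (fun t : ℝ => sumEntropy (fun _ : ι => t)) (Set.Icc 0 (1 / 2)) := by
      refine strictMonoOn_of_deriv_pos (convex_Icc _ _) hcont.continuousOn fun s hs => ?_
      rw [interior_Icc] at hs
      have hs' : s ∈ Set.Ioo (0 : ℝ) 1 := ⟨hs.1, hs.2.trans hhalf.2⟩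
      rw [hder s hs']
      have := strictAntiOn_binomialEntropySlope m hs' hhalf hs.2
      rw [binomialEntropySlope_half] at this
      exact mul_pos hm0 this
    exact hmono ⟨hc.1, h.le⟩ ⟨hhalf.1.le, le_rfl⟩ h
  · have hanti : StrictAntiOn (fun t : ℝ => sumEntropy (fun _ : ι => t)) (Set.Icc (1 / 2) 1) := by
      refine strictAntiOn_of_deriv_neg (convex_Icc _ _) hcont.continuousOn fun s hs => ?_
      rw [interior_Icc] at hs
      have hs' : s ∈ Set.Ioo (0 : ℝ) 1 := ⟨hhalf.1.trans hs.1, hs.2⟩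
      rw [hder s hs']
      have := strictAntiOn_binomialEntropySlope m hhalf hs' hs.1
      rw [binomialEntropySlope_half] at this
      exact mul_neg_of_pos_of_neg hm0 this
    exact hanti ⟨le_rfl, hhalf.2.le⟩ ⟨h.le, hc.2⟩ h

/-- Among sums of independent Bernoulli variables, the entropy is maximal only when all the
parameters are `1 / 2`. -/
theorem sumEntropy_lt_half {p : ι → ℝ} (hp : ∀ i, p i ∈ Set.Icc (0 : ℝ) 1)
    (hne : p ≠ fun _ => 1 / 2) : sumEntropy p < sumEntropy (fun _ : ι => (1 / 2 : ℝ)) := by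
  obtain ⟨i, hi⟩ := Function.ne_iff.1 hne
  have : Nonempty ι := ⟨i⟩
  by_cases hconst : ∀ l, p l = p i
  · rw [show p = fun _ => p i from funext hconst]
    exact sumEntropy_const_lt (hp i) hi
  · push Not at hconst
    obtain ⟨l, hl⟩ := hconst
    obtain ⟨c, hc, hlt⟩ := sumEntropy_lt_average hp hl
    rcases eq_or_ne c (1 / 2) with h | h
    · rwa [h] at hlt
    · exact hlt.trans (sumEntropy_const_lt hc h)

end BinomialEntropy

namespace RAC

theorem mutualInfo_lt_equiprobable {δ : ℝ} (hδ : δ < 1) {k : ℕ} {P : Fin k → Fin 2 → ℝ}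
    (hP : P ∈ inputLaws k (Fin 2)) (hne : P ≠ equiprobable k) :
    mutualInfo (adderErasure δ k) P < mutualInfo (adderErasure δ k) (equiprobable k) := by
  rw [mutualInfo_adderErasure δ hP, mutualInfo_adderErasure δ (equiprobable_mem_inputLaws k)]
  refine mul_lt_mul_of_pos_left ?_ (sub_pos.2 hδ)
  refine sumEntropy_lt_half (fun i => mem_Icc_of_mem_inputLaws hP i) fun h => hne ?_
  funext i b
  have h1 : P i 1 = 1 / 2 := congrFun h i
  have h0 := one_sub_of_mem_inputLaws hP i
  fin_cases b
  · change P i 0 = 1 / 2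
    linarith
  · exact h1

theorem isMaxOn_equiprobable {δ : ℝ} (hδ : δ ∈ Set.Icc (0 : ℝ) 1) (k : ℕ) :
    IsMaxOn (mutualInfo (adderErasure δ k)) (inputLaws k (Fin 2)) (equiprobable k) := by
  intro P hP
  change mutualInfo _ P ≤ mutualInfo _ _
  rcases eq_or_ne P (equiprobable k) with h | h
  · rw [h]
  · rcases hδ.2.lt_or_eq with h1 | h1
    · exact (mutualInfo_lt_equiprobable h1 hP h).le
    · rw [mutualInfo_adderErasure δ hP, mutualInfo_adderErasure δ (equiprobable_mem_inputLaws k),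
        h1]
      simp

end RAC

/-! ### Stirling's formula with its first correction -/

section Stirling

open Filter Topology

theorem tendsto_log_stirlingSeq_succ :
    Tendsto (fun m : ℕ => Real.log (Stirling.stirlingSeq (m + 1))) atTop
      (𝓝 (Real.log Real.pi / 2)) := by
  have h := (Stirling.tendsto_stirlingSeq_sqrt_pi.log (by positivity)).comp (tendsto_add_atTop_nat 1)
  rwa [Real.log_sqrt Real.pi_pos.le] at h

theorem log_stirlingSeq_sub_succ_ge (m : ℕ) :
    1 / (3 * (2 * ((m : ℝ) + 1) + 1) ^ 2)
      ≤ Real.log (Stirling.stirlingSeq (m + 1)) - Real.log (Stirling.stirlingSeq (m + 2)) := by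
  refine le_trans (le_of_eq ?_)
    ((Stirling.log_stirlingSeq_sdiff_hasSum m).summable.sum_le_tsum {0} fun k _ => by positivity) |>.trans
    (le_of_eq (Stirling.log_stirlingSeq_sdiff_hasSum m).tsum_eq)
  simp only [Finset.sum_singleton]
  push_cast
  field_simp
  norm_num

/-- The error of Stirling's formula with its `1 / (12 m)` correction. -/
noncomputable def stirlingError (m : ℕ) : ℝ :=
  Real.log m.factorial - ((m + 1 / 2) * Real.log m - m + Real.log (2 * Real.pi) / 2 + 1 / (12 * m))

/-- `stirlingError` increases to `0`, and it decreases to `0` after adding `1 / m ^ 3`, because the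
decrements of the logarithm of the Stirling sequence lie between the first term of their power
series and the decrements of `1 / (12 m)`. -/
theorem abs_stirlingError_le {m : ℕ} (hm : 0 < m) : |stirlingError m| ≤ 1 / (m : ℝ) ^ 3 := by
  obtain ⟨m, rfl⟩ : ∃ l, m = l + 1 := ⟨m - 1, by omega⟩
  have hinv : Tendsto (fun m : ℕ => 1 / ((m : ℝ) + 1)) atTop (𝓝 0) :=
    tendsto_one_div_add_atTop_nhds_zero_nat
  set d : ℕ → ℝ := fun m => Real.log (Stirling.stirlingSeq (m + 1)) - Real.log Real.pi / 2
    - 1 / 12 * (1 / ((m : ℝ) + 1)) with hd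
  have hdlim : Tendsto d atTop (𝓝 0) := by
    have := (tendsto_log_stirlingSeq_succ.sub_const (Real.log Real.pi / 2)).sub
      (hinv.const_mul (1 / 12))
    rwa [sub_self, mul_zero, sub_zero] at this
  have hmono : Monotone d := by
    refine monotone_nat_of_le_succ fun m => ?_
    have h := Stirling.log_stirlingSeq_sdiff_le (m + 1)
    have e : 1 / (12 * ((m : ℝ) + 1) * ((m : ℝ) + 1 + 1))
        = 1 / 12 * (1 / ((m : ℝ) + 1)) - 1 / 12 * (1 / ((m : ℝ) + 1 + 1)) := by
      field_simp
      ring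
    push_cast at h
    rw [e] at h
    simp only [hd]
    push_cast
    linarith
  have hanti : Antitone fun m => d m + (1 / ((m : ℝ) + 1)) ^ 3 := by
    refine antitone_nat_of_succ_le fun m => ?_
    have h := log_stirlingSeq_sub_succ_ge m
    have e : 1 / 12 * (1 / ((m : ℝ) + 1)) - 1 / 12 * (1 / ((m : ℝ) + 1 + 1))
        + (1 / ((m : ℝ) + 1 + 1)) ^ 3 ≤
        1 / (3 * (2 * ((m : ℝ) + 1) + 1) ^ 2) + (1 / ((m : ℝ) + 1)) ^ 3 := by
      have hx : (0 : ℝ) ≤ m := m.cast_nonneg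
      generalize (m : ℝ) = x at hx
      rw [← sub_nonneg]
      have : 1 / (3 * (2 * (x + 1) + 1) ^ 2) + (1 / (x + 1)) ^ 3
          - (1 / 12 * (1 / (x + 1)) - 1 / 12 * (1 / (x + 1 + 1)) + (1 / (x + 1 + 1)) ^ 3)
          = (12 * (2 * (x + 1) + 1) ^ 2 * (3 * (x + 1) ^ 2 + 3 * (x + 1) + 1)
            - (x + 1) ^ 2 * (x + 2) ^ 2)
            / (12 * (2 * (x + 1) + 1) ^ 2 * (x + 1) ^ 3 * (x + 2) ^ 3) := by
        rw [show x + 1 + 1 = x + 2 by ring]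
        field_simp
        ring
      rw [this]
      refine div_nonneg ?_ (by positivity)
      ring_nf
      positivity
    simp only [hd]
    push_cast
    linarith
  have hle : d m ≤ 0 := hmono.ge_of_tendsto hdlim m
  have hge : 0 ≤ d m + (1 / ((m : ℝ) + 1)) ^ 3 := by
    refine hanti.le_of_tendsto (a := 0) ?_ m
    simpa using hdlim.add (hinv.pow 3)
  have hm0 : (0 : ℝ) < (m : ℝ) + 1 := by positivity
  have heq : stirlingError (m + 1) = d m := by
    simp only [hd, stirlingError]
    rw [Stirling.log_stirlingSeq_formula]
    push_cast
    rw [Real.log_mul two_ne_zero Real.pi_ne_zero, Real.log_mul two_ne_zero hm0.ne',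
      Real.log_div hm0.ne' (Real.exp_ne_zero 1), Real.log_exp]
    field_simp
    ring
  rw [heq, abs_le]
  push_cast
  rw [← one_div_pow]
  have : 0 < (1 / ((m : ℝ) + 1)) ^ 3 := by positivity
  constructor <;> linarith

end Stirling

/-! ### Moments of the symmetric binomial law -/

section BinomialMoments

open Finset

/-- The average of a function against the symmetric binomial law with `n` trials. -/
noncomputable def binomialAvg (n : ℕ) : (ℕ → ℝ) →ₗ[ℝ] ℝ :=
  ∑ j ∈ range (n + 1), ((n.choose j : ℝ) / 2 ^ n) • LinearMap.proj j

theorem binomialAvg_apply (n : ℕ) (g : ℕ → ℝ) :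
    binomialAvg n g = ∑ j ∈ range (n + 1), (n.choose j : ℝ) / 2 ^ n * g j := by
  simp [binomialAvg, LinearMap.sum_apply]

theorem binomialAvg_mono {n : ℕ} {g h : ℕ → ℝ} (hgh : ∀ j ≤ n, g j ≤ h j) :
    binomialAvg n g ≤ binomialAvg n h := by
  rw [binomialAvg_apply, binomialAvg_apply]
  exact sum_le_sum fun j hj => mul_le_mul_of_nonneg_left
    (hgh j (Nat.lt_succ_iff.1 (mem_range.1 hj))) (by positivity)

theorem abs_binomialAvg_le {n : ℕ} {g h : ℕ → ℝ} (hgh : ∀ j ≤ n, |g j| ≤ h j) :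
    |binomialAvg n g| ≤ binomialAvg n h := by
  rw [abs_le]
  constructor
  · rw [← map_neg]
    exact binomialAvg_mono fun j hj => (abs_le.1 (hgh j hj)).1
  · exact binomialAvg_mono fun j hj => (abs_le.1 (hgh j hj)).2

/-- The centred binomial variable `2 j - n`, a sum of `n` independent random signs. -/
def signSum (n j : ℕ) : ℝ := 2 * j - n

/-- Conditioning on the last of `n + 1` random signs. -/
theorem binomialAvg_succ_comp_signSum (n : ℕ) (g : ℝ → ℝ) :
    binomialAvg (n + 1) (fun j => g (signSum (n + 1) j))
      = binomialAvg n (fun j => 1 / 2 * (g (signSum n j - 1) + g (signSum n j + 1))) := by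
  have h := sum_choose_succ_mul (fun i j => g ((i : ℝ) - j)) n
  rw [binomialAvg_apply, binomialAvg_apply]
  have e0 : ∑ j ∈ range (n + 1 + 1), ((n + 1).choose j : ℝ) / 2 ^ (n + 1) * g (signSum (n + 1) j)
      = 1 / 2 ^ (n + 1) *
        ∑ i ∈ range (n + 2), ((n + 1).choose i : ℝ) * g ((i : ℝ) - (n + 1 - i : ℕ)) := by
    rw [mul_sum]
    refine sum_congr rfl fun j hj => ?_
    have hj' : j ≤ n + 1 := Nat.lt_succ_iff.1 (mem_range.1 hj)
    rw [Nat.cast_sub hj', signSum,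
      show (2 * (j : ℝ) - (n + 1 : ℕ)) = (j : ℝ) - ((n + 1 : ℕ) - j) by ring]
    ring
  rw [e0, h, ← sum_add_distrib, mul_sum]
  refine sum_congr rfl fun j hj => ?_
  have hj' : j ≤ n := Nat.lt_succ_iff.1 (mem_range.1 hj)
  rw [Nat.cast_sub hj', Nat.cast_sub (by omega : j ≤ n + 1), signSum,
    show (j : ℝ) - ((n + 1 : ℕ) - j) = 2 * j - n - 1 by push_cast; ring,
    show ((j + 1 : ℕ) : ℝ) - (n - j) = 2 * j - n + 1 by push_cast; ring, pow_succ]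
  field_simp

theorem binomialAvg_one (n : ℕ) : binomialAvg n 1 = 1 := by
  rw [binomialAvg_apply]
  simp only [Pi.one_apply, mul_one, ← sum_div]
  rw [div_eq_one_iff_eq (by positivity)]
  exact_mod_cast Nat.sum_range_choose n

theorem binomialAvg_signSum_pow (n : ℕ) :
    binomialAvg n (signSum n ^ 2) = n ∧
    binomialAvg n (signSum n ^ 4) = 3 * n ^ 2 - 2 * n ∧
    binomialAvg n (signSum n ^ 6) = 15 * n ^ 3 - 30 * n ^ 2 + 16 * n ∧
    binomialAvg n (signSum n ^ 8) = 105 * n ^ 4 - 420 * n ^ 3 + 588 * n ^ 2 - 272 * n := by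
  induction n with
  | zero => simp [binomialAvg_apply, signSum]
  | succ n ih =>
    obtain ⟨h2, h4, h6, h8⟩ := ih
    have h0 := binomialAvg_one n
    have e2 : binomialAvg (n + 1) (signSum (n + 1) ^ 2)
        = binomialAvg n (signSum n ^ 2 + 1) := by
      refine (binomialAvg_succ_comp_signSum n (· ^ 2)).trans (congrArg _ (funext fun j => ?_))
      simp only [Pi.add_apply, Pi.pow_apply, Pi.one_apply]
      ring
    have e4 : binomialAvg (n + 1) (signSum (n + 1) ^ 4)
        = binomialAvg n (signSum n ^ 4 + (6 : ℝ) • signSum n ^ 2 + 1) := by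
      refine (binomialAvg_succ_comp_signSum n (· ^ 4)).trans (congrArg _ (funext fun j => ?_))
      simp only [Pi.add_apply, Pi.pow_apply, Pi.one_apply, Pi.smul_apply, smul_eq_mul]
      ring
    have e6 : binomialAvg (n + 1) (signSum (n + 1) ^ 6)
        = binomialAvg n (signSum n ^ 6 + (15 : ℝ) • signSum n ^ 4
          + (15 : ℝ) • signSum n ^ 2 + 1) := by
      refine (binomialAvg_succ_comp_signSum n (· ^ 6)).trans (congrArg _ (funext fun j => ?_))
      simp only [Pi.add_apply, Pi.pow_apply, Pi.one_apply, Pi.smul_apply, smul_eq_mul]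
      ring
    have e8 : binomialAvg (n + 1) (signSum (n + 1) ^ 8)
        = binomialAvg n (signSum n ^ 8 + (28 : ℝ) • signSum n ^ 6 + (70 : ℝ) • signSum n ^ 4
          + (28 : ℝ) • signSum n ^ 2 + 1) := by
      refine (binomialAvg_succ_comp_signSum n (· ^ 8)).trans (congrArg _ (funext fun j => ?_))
      simp only [Pi.add_apply, Pi.pow_apply, Pi.one_apply, Pi.smul_apply, smul_eq_mul]
      ring
    rw [e2, e4, e6, e8]
    simp only [map_add, map_smul, smul_eq_mul, h0, h2, h4, h6, h8]
    push_cast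
    refine ⟨by ring, by ring, by ring, by ring⟩

/-- The square of the normalized binomial variable, `(2 j - n) ^ 2 / n`. -/
noncomputable def normSq (n : ℕ) : ℕ → ℝ := (n : ℝ)⁻¹ • signSum n ^ 2

theorem normSq_apply (n j : ℕ) : normSq n j = (2 * j - n) ^ 2 / n := by
  simp only [normSq, signSum, Pi.smul_apply, Pi.pow_apply, smul_eq_mul]
  ring

theorem normSq_nonneg (n j : ℕ) : 0 ≤ normSq n j := by
  rw [normSq_apply]; positivity

theorem binomialAvg_normSq_pow {n : ℕ} (hn : 0 < n) :
    binomialAvg n (normSq n) = 1 ∧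
    binomialAvg n (normSq n ^ 2) = 3 - 2 / n ∧
    binomialAvg n (normSq n ^ 3) = 15 - 30 / n + 16 / n ^ 2 ∧
    binomialAvg n (normSq n ^ 4) = 105 - 420 / n + 588 / n ^ 2 - 272 / n ^ 3 := by
  obtain ⟨h2, h4, h6, h8⟩ := binomialAvg_signSum_pow n
  have hn' : (n : ℝ) ≠ 0 := by positivity
  simp only [normSq, smul_pow, ← pow_mul, map_smul, smul_eq_mul, Nat.reduceMul, h2, h4, h6, h8]
  refine ⟨?_, ?_, ?_, ?_⟩ <;> field_simp

theorem binomialAvg_exp_signSum (n : ℕ) (t : ℝ) :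
    binomialAvg n (fun j => Real.exp (t * signSum n j)) = Real.cosh t ^ n := by
  induction n with
  | zero => simp [binomialAvg_apply, signSum]
  | succ n ih =>
    rw [binomialAvg_succ_comp_signSum n (fun x => Real.exp (t * x)), pow_succ', ← ih,
      ← smul_eq_mul, ← map_smul]
    refine congrArg _ (funext fun j => ?_)
    simp only [Pi.smul_apply, smul_eq_mul, mul_add, mul_sub, mul_one, Real.exp_add, Real.exp_sub,
      Real.cosh_eq, Real.exp_neg]
    ring

/-- The moments of the normalized binomial variable are bounded, by comparison of powers with the
hyperbolic cosine, whose average is at most `exp (1 / 2)`. -/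
theorem binomialAvg_normSq_pow_le {n : ℕ} (hn : 0 < n) (k : ℕ) :
    binomialAvg n (normSq n ^ k) ≤ (2 * k).factorial * Real.exp (1 / 2) := by
  have hn' : (0 : ℝ) < n := by exact_mod_cast hn
  set t : ℝ := 1 / √n with ht
  have ht2 : t ^ 2 = (n : ℝ)⁻¹ := by
    rw [ht, div_pow, Real.sq_sqrt hn'.le, one_pow, one_div]
  have hcosh : binomialAvg n (fun j => Real.cosh (t * signSum n j)) ≤ Real.exp (1 / 2) := by
    have h : binomialAvg n (fun j => Real.cosh (t * signSum n j)) = Real.cosh t ^ n := by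
      have : (fun j => Real.cosh (t * signSum n j))
          = (1 / 2 : ℝ) • ((fun j => Real.exp (t * signSum n j))
            + fun j => Real.exp (-t * signSum n j)) := by
        funext j
        simp only [Pi.smul_apply, Pi.add_apply, smul_eq_mul, Real.cosh_eq, neg_mul]
        ring
      rw [this, map_smul, map_add, binomialAvg_exp_signSum, binomialAvg_exp_signSum,
        Real.cosh_neg, smul_eq_mul]
      ring
    rw [h]
    refine (pow_le_pow_left₀ (Real.cosh_pos t).le (Real.cosh_le_exp_half_sq t) n).trans ?_
    rw [← Real.exp_nat_mul, ht2]
    refine Real.exp_le_exp.2 (le_of_eq ?_)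
    field_simp
  have hpt : ∀ j ≤ n, (normSq n ^ k) j
      ≤ (((2 * k).factorial : ℝ) • fun j => Real.cosh (t * signSum n j)) j := by
    intro j _
    have hfac : (0 : ℝ) < (2 * k).factorial := by positivity
    have hs := le_hasSum (Real.hasSum_cosh (t * signSum n j)) k fun i _ => by
      rw [pow_mul]; positivity
    rw [div_le_iff₀ hfac] at hs
    simp only [Pi.smul_apply, smul_eq_mul, Pi.pow_apply, normSq]
    rw [← ht2, ← mul_pow, ← pow_mul]
    linarith
  refine (binomialAvg_mono hpt).trans ?_
  rw [map_smul, smul_eq_mul]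
  exact mul_le_mul_of_nonneg_left hcosh (by positivity)

end BinomialMoments

/-! ### Pointwise expansion of the symmetric binomial law -/

section LocalExpansion

open Finset

theorem abs_log_one_sub_add_sum_le {x : ℝ} (hx : |x| ≤ 1 / 2) (n : ℕ) :
    |(∑ i ∈ range n, x ^ (i + 1) / (i + 1)) + Real.log (1 - x)| ≤ 2 * |x| ^ (n + 1) := by
  refine (Real.abs_log_sub_add_sum_range_le (by linarith) n).trans ?_
  rw [div_le_iff₀ (by linarith)]
  have : 0 ≤ |x| ^ (n + 1) := by positivity
  nlinarith

theorem abs_mul_le_of_nonneg {a b c : ℝ} (ha : 0 ≤ a) (hb : |b| ≤ c) : |a * b| ≤ a * c := by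
  rw [abs_mul, abs_of_nonneg ha]
  exact mul_le_mul_of_nonneg_left hb ha

/-- Expansion of the binary relative entropy at `1 / 2`. -/
theorem abs_binEntropy_expansion_le {u : ℝ} (hu : |u| ≤ 1 / 2) :
    |(1 + u) * Real.log (1 + u) + (1 - u) * Real.log (1 - u)
      - (u ^ 2 + u ^ 4 / 6 + u ^ 6 / 15)| ≤ 5 * u ^ 8 := by
  have h1 := abs_log_one_sub_add_sum_le hu 7
  have h2 := abs_log_one_sub_add_sum_le (x := -u) (by rwa [abs_neg]) 7
  rw [abs_neg] at h2
  have e8 : |u| ^ (7 + 1) = u ^ 8 := Even.pow_abs (by decide) u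
  rw [e8] at h1 h2
  simp only [sum_range_succ, range_zero, sum_empty, sub_neg_eq_add] at h1 h2
  norm_num at h1 h2
  obtain ⟨hu1, hu2⟩ := abs_le.1 hu
  rw [abs_le] at h1 h2 ⊢
  have a1 := mul_le_mul_of_nonneg_left h1.1 (by linarith : (0 : ℝ) ≤ 1 - u)
  have a2 := mul_le_mul_of_nonneg_left h1.2 (by linarith : (0 : ℝ) ≤ 1 - u)
  have b1 := mul_le_mul_of_nonneg_left h2.1 (by linarith : (0 : ℝ) ≤ 1 + u)
  have b2 := mul_le_mul_of_nonneg_left h2.2 (by linarith : (0 : ℝ) ≤ 1 + u)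
  have hp : 0 ≤ u ^ 8 := by positivity
  constructor <;> nlinarith

theorem abs_log_one_add_add_log_one_sub_le {u : ℝ} (hu : |u| ≤ 1 / 2) :
    |Real.log (1 + u) + Real.log (1 - u) + (u ^ 2 + u ^ 4 / 2)| ≤ 4 * u ^ 6 := by
  have h1 := abs_log_one_sub_add_sum_le hu 5
  have h2 := abs_log_one_sub_add_sum_le (x := -u) (by rwa [abs_neg]) 5
  rw [abs_neg] at h2
  have e6 : |u| ^ (5 + 1) = u ^ 6 := Even.pow_abs (by decide) u
  rw [e6] at h1 h2
  simp only [sum_range_succ, range_zero, sum_empty, sub_neg_eq_add] at h1 h2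
  norm_num at h1 h2
  rw [abs_le] at h1 h2 ⊢
  constructor <;> linarith [h1.1, h1.2, h2.1, h2.2]

theorem abs_inv_one_sub_sq_sub_le {u : ℝ} (hu : |u| ≤ 1 / 2) :
    |1 / (1 - u ^ 2) - (1 + u ^ 2)| ≤ 2 * u ^ 4 := by
  have hu2 : u ^ 2 ≤ 1 / 4 := by
    rw [← sq_abs]; nlinarith [abs_nonneg u]
  have hpos : 0 < 1 - u ^ 2 := by linarith
  have : 1 / (1 - u ^ 2) - (1 + u ^ 2) = u ^ 4 / (1 - u ^ 2) := by
    field_simp; ring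
  rw [this, abs_of_nonneg (by positivity), div_le_iff₀ hpos]
  have : 0 ≤ u ^ 4 := by positivity
  nlinarith

/-- The constant term of the expansion of the logarithm of the symmetric binomial law. -/
noncomputable def logBinomialConst (n : ℕ) : ℝ :=
  -(1 / 2) * Real.log (Real.pi * n / 2) - 1 / (4 * n)

/-- The expansion of minus the logarithm of the symmetric binomial law, up to its constant term, as
a function of the normalized square `x = (2 j - n) ^ 2 / n`. -/
noncomputable def logBinomialPoly (n : ℕ) (x : ℝ) : ℝ :=
  x / 2 + (x ^ 2 / 12 - x / 2) / n + (x ^ 3 / 30 - x ^ 2 / 4 + x / 3) / n ^ 2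

/-- The error of the expansion of the binomial law in terms of the errors of the elementary
expansions in the parameter `u = (2 j - n) / n`. -/
theorem log_choose_sub_eq {n j : ℕ} {u : ℝ} (hn : 0 < n) (hj : j ≤ n) (hu : |u| ≤ 1 / 2)
    (hju : (j : ℝ) = n / 2 * (1 + u)) (hnju : ((n - j : ℕ) : ℝ) = n / 2 * (1 - u)) :
    Real.log ((n.choose j : ℝ) / 2 ^ n) - (logBinomialConst n - logBinomialPoly n (n * u ^ 2))
      = stirlingError n - stirlingError j - stirlingError (n - j)
        - n / 2 * ((1 + u) * Real.log (1 + u) + (1 - u) * Real.log (1 - u)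
          - (u ^ 2 + u ^ 4 / 6 + u ^ 6 / 15))
        - 1 / 2 * (Real.log (1 + u) + Real.log (1 - u) + (u ^ 2 + u ^ 4 / 2))
        - 1 / (3 * n) * (1 / (1 - u ^ 2) - (1 + u ^ 2)) := by
  have hn' : (0 : ℝ) < n := by exact_mod_cast hn
  obtain ⟨hu1, hu2⟩ := abs_le.1 hu
  have hp : 0 < 1 + u := by linarith
  have hm : 0 < 1 - u := by linarith
  have hchoose : Real.log ((n.choose j : ℝ) / 2 ^ n) = Real.log n.factorial - Real.log j.factorial
      - Real.log (n - j).factorial - n * Real.log 2 := by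
    rw [Nat.cast_choose ℝ hj, Real.log_div (by positivity) (by positivity),
      Real.log_div (by positivity) (by positivity), Real.log_mul (by positivity) (by positivity),
      Real.log_pow]
    ring
  have hlj : Real.log j = Real.log n - Real.log 2 + Real.log (1 + u) := by
    rw [hju, Real.log_mul (by positivity) hp.ne', Real.log_div hn'.ne' two_ne_zero]
  have hlnj : Real.log (n - j : ℕ) = Real.log n - Real.log 2 + Real.log (1 - u) := by
    rw [hnju, Real.log_mul (by positivity) hm.ne', Real.log_div hn'.ne' two_ne_zero]
  have hc0 : logBinomialConst n = -(1 / 2) * (Real.log Real.pi + Real.log n - Real.log 2)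
      - 1 / (4 * n) := by
    rw [logBinomialConst, Real.log_div (by positivity) two_ne_zero,
      Real.log_mul Real.pi_ne_zero hn'.ne']
  have h12 : 1 / (12 * (j : ℝ)) + 1 / (12 * ((n - j : ℕ) : ℝ)) = 1 / (3 * n) * (1 / (1 - u ^ 2)) := by
    rw [hju, hnju, show 1 - u ^ 2 = (1 + u) * (1 - u) by ring]
    field_simp
    ring
  have h2π : Real.log (2 * Real.pi) = Real.log 2 + Real.log Real.pi :=
    Real.log_mul two_ne_zero Real.pi_ne_zero
  have hpoly : logBinomialPoly n (n * u ^ 2) = n / 2 * (u ^ 2 + u ^ 4 / 6 + u ^ 6 / 15)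
      - 1 / 2 * (u ^ 2 + u ^ 4 / 2) + 1 / (3 * n) * u ^ 2 := by
    rw [logBinomialPoly]
    field_simp
    ring
  have hsplit : 1 / (4 * (n : ℝ)) = 1 / (3 * n) - 1 / (12 * n) := by field_simp; norm_num
  rw [hpoly, hc0, hchoose, hsplit, stirlingError, stirlingError, stirlingError, hlj, hlnj, h2π]
  rw [hju, hnju] at h12 ⊢
  linear_combination -h12

/-- In the bulk the expansion of the binomial law follows from Stirling's formula. -/
theorem abs_log_choose_sub_le_of_central {n j : ℕ} (hn : 0 < n) (hj : j ≤ n)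
    (hc : |2 * (j : ℝ) - n| ≤ n / 2) :
    |Real.log ((n.choose j : ℝ) / 2 ^ n)
      - (logBinomialConst n - logBinomialPoly n (normSq n j))|
      ≤ 200 * (1 + normSq n j ^ 4) / n ^ 3 := by
  have hn' : (0 : ℝ) < n := by exact_mod_cast hn
  have hjn : ((n - j : ℕ) : ℝ) = n - j := Nat.cast_sub hj
  obtain ⟨hc1, hc2⟩ := abs_le.1 hc
  have hj4 : (n : ℝ) / 4 ≤ j := by linarith
  have hnj4 : (n : ℝ) / 4 ≤ (n - j : ℕ) := by rw [hjn]; linarith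
  have hquart : ∀ m : ℕ, (n : ℝ) / 4 ≤ m → |stirlingError m| ≤ 64 / (n : ℝ) ^ 3 := fun m hm => by
    have hm0 : (0 : ℝ) < m := lt_of_lt_of_le (by positivity) hm
    calc |stirlingError m| ≤ 1 / (m : ℝ) ^ 3 :=
          abs_stirlingError_le (by exact_mod_cast hm0)
      _ ≤ 1 / ((n : ℝ) / 4) ^ 3 := by gcongr
      _ = 64 / (n : ℝ) ^ 3 := by field_simp; norm_num
  obtain ⟨u, hu⟩ : ∃ u : ℝ, u = (2 * j - n) / n := ⟨_, rfl⟩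
  have hule : |u| ≤ 1 / 2 := by
    rw [hu, abs_div, abs_of_pos hn', div_le_iff₀ hn']; linarith
  have hjeq : (j : ℝ) = n / 2 * (1 + u) := by rw [hu]; field_simp; ring
  have hnjeq : ((n - j : ℕ) : ℝ) = n / 2 * (1 - u) := by rw [hjn, hu]; field_simp; ring
  have hX : normSq n j = n * u ^ 2 := by rw [normSq_apply, hu]; field_simp
  rw [hX, log_choose_sub_eq hn hj hule hjeq hnjeq]
  have hbound := (abs_sub _ _).trans (add_le_add ((abs_sub _ _).trans (add_le_add
      ((abs_sub _ _).trans (add_le_add ((abs_sub _ _).trans (add_le_add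
        ((abs_sub _ _).trans (add_le_add (hquart n (by linarith)) (hquart j hj4)))
          (hquart (n - j) hnj4))) (abs_mul_le_of_nonneg (by positivity : (0 : ℝ) ≤ n / 2)
            (abs_binEntropy_expansion_le hule)))) (abs_mul_le_of_nonneg (by norm_num : (0 : ℝ) ≤ 1 / 2)
          (abs_log_one_add_add_log_one_sub_le hule))))
      (abs_mul_le_of_nonneg (by positivity : (0 : ℝ) ≤ 1 / (3 * n))
        (abs_inv_one_sub_sq_sub_le hule)))
  refine hbound.trans ?_
  have hx0 : 0 ≤ n * u ^ 2 := by positivity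
  have hu2 : u ^ 2 = n * u ^ 2 / n := by field_simp
  have e4 : u ^ 4 = (n * u ^ 2 / n) ^ 2 := by rw [← hu2]; ring
  have e6 : u ^ 6 = (n * u ^ 2 / n) ^ 3 := by rw [← hu2]; ring
  have e8 : u ^ 8 = (n * u ^ 2 / n) ^ 4 := by rw [← hu2]; ring
  rw [e4, e6, e8]
  generalize n * u ^ 2 = x at hx0
  have hsum : 64 / (n : ℝ) ^ 3 + 64 / (n : ℝ) ^ 3 + 64 / (n : ℝ) ^ 3 + n / 2 * (5 * (x / n) ^ 4)
        + 1 / 2 * (4 * (x / n) ^ 3) + 1 / (3 * n) * (2 * (x / n) ^ 2)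
      = (192 + 5 / 2 * x ^ 4 + 2 * x ^ 3 + 2 / 3 * x ^ 2) / n ^ 3 := by
    field_simp
    ring
  rw [hsum]
  gcongr
  have h2 : x ^ 2 ≤ 1 + x ^ 4 := by nlinarith [sq_nonneg (x ^ 2 - 1)]
  have h3 : x ^ 3 ≤ 1 + x ^ 4 := by nlinarith [sq_nonneg (x ^ 2 - x), sq_nonneg (x ^ 2 - 1)]
  have h4 : 0 ≤ x ^ 4 := by positivity
  linarith

/-- Away from the bulk, `n ≤ 4 x` for the normalized square `x`, so that crude bounds linear in `n`
are already of the required order. -/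
theorem abs_log_choose_sub_le_of_tail {n j : ℕ} (hn : 0 < n) (hj : j ≤ n)
    (hc : (n : ℝ) / 2 ≤ |2 * (j : ℝ) - n|) :
    |Real.log ((n.choose j : ℝ) / 2 ^ n)
      - (logBinomialConst n - logBinomialPoly n (normSq n j))|
      ≤ 1536 * (1 + normSq n j ^ 4) / n ^ 3 := by
  have hn' : (0 : ℝ) < n := by exact_mod_cast hn
  have hn1 : (1 : ℝ) ≤ n := by exact_mod_cast hn
  have hjn : (j : ℝ) ≤ n := by exact_mod_cast hj
  have hx4 : (n : ℝ) ≤ 4 * normSq n j := by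
    rw [normSq_apply, ← sq_abs, ← mul_div_assoc, le_div_iff₀ hn']
    nlinarith
  have hxn : normSq n j ≤ n := by
    rw [normSq_apply, div_le_iff₀ hn']
    nlinarith [(Nat.cast_nonneg j : (0 : ℝ) ≤ j)]
  have hlog : |Real.log ((n.choose j : ℝ) / 2 ^ n)| ≤ n := by
    have hc1 : (1 : ℝ) ≤ n.choose j := by exact_mod_cast Nat.choose_pos hj
    have hc2 : (n.choose j : ℝ) ≤ 2 ^ n := by exact_mod_cast Nat.choose_le_two_pow n j
    rw [Real.log_div (by positivity) (by positivity), Real.log_pow]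
    have l1 := Real.log_nonneg hc1
    have l2 := Real.log_le_log (by positivity) hc2
    rw [Real.log_pow] at l2
    have l3 : (n : ℝ) * Real.log 2 ≤ n := by
      have := Real.log_two_lt_d9
      nlinarith
    rw [abs_le]
    constructor <;> linarith
  have hconst : |logBinomialConst n| ≤ 2 * n := by
    have hπ := Real.pi_gt_three
    have hπ' := Real.pi_lt_four
    have l1 : 0 ≤ Real.log (Real.pi * n / 2) := Real.log_nonneg (by nlinarith)
    have l2 := Real.log_le_sub_one_of_pos (show 0 < Real.pi * n / 2 by positivity)
    have l3 : 0 < 1 / (4 * (n : ℝ)) := by positivity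
    have l4 : 1 / (4 * (n : ℝ)) ≤ 1 / 4 := by
      rw [div_le_div_iff₀ (by positivity) (by norm_num)]; linarith
    have l5 : Real.pi * n ≤ 4 * n := by nlinarith
    rw [logBinomialConst, abs_le]
    constructor <;> linarith
  have hpoly : |logBinomialPoly n (normSq n j)| ≤ 3 * n := by
    have hx0 := normSq_nonneg n j
    generalize normSq n j = x at hx0 hxn
    have q1 : x / n ≤ 1 := (div_le_one hn').2 hxn
    have q0 : 0 ≤ x / n := by positivity
    have e : logBinomialPoly n x = n * (x / n) / 2 + n * (x / n) ^ 2 / 12 - (x / n) / 2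
        + n * (x / n) ^ 3 / 30 - (x / n) ^ 2 / 4 + 1 / n * (x / n) / 3 := by
      rw [logBinomialPoly]; field_simp; ring
    rw [e]
    generalize x / n = y at q1 q0
    have y2 : y ^ 2 ≤ 1 := pow_le_one₀ q0 q1
    have y3 : y ^ 3 ≤ 1 := pow_le_one₀ q0 q1
    have y2' : 0 ≤ y ^ 2 := by positivity
    have y3' : 0 ≤ y ^ 3 := by positivity
    have n1 : 1 / (n : ℝ) ≤ 1 := (div_le_one hn').2 hn1
    have t1 := mul_le_mul_of_nonneg_left q1 hn'.le
    have t2 := mul_le_mul_of_nonneg_left y2 hn'.le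
    have t3 := mul_le_mul_of_nonneg_left y3 hn'.le
    have s1 := mul_nonneg hn'.le q0
    have s2 := mul_nonneg hn'.le y2'
    have s3 := mul_nonneg hn'.le y3'
    have t4 : 1 / (n : ℝ) * y ≤ 1 := mul_le_one₀ n1 q0 q1
    have s4 : 0 ≤ 1 / (n : ℝ) * y := by positivity
    rw [abs_le]
    constructor <;> linarith
  have hcrude : |Real.log ((n.choose j : ℝ) / 2 ^ n)
      - (logBinomialConst n - logBinomialPoly n (normSq n j))| ≤ 6 * n := by
    rw [abs_le] at hlog hconst hpoly ⊢
    constructor <;> linarith [hlog.1, hlog.2, hconst.1, hconst.2, hpoly.1, hpoly.2]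
  -- `6 n ≤ 6 n (4 x / n) ^ 4 = 1536 x ^ 4 / n ^ 3`
  refine hcrude.trans ?_
  rw [le_div_iff₀ (by positivity)]
  have := pow_le_pow_left₀ hn'.le hx4 4
  nlinarith

theorem abs_log_choose_sub_le {n j : ℕ} (hn : 0 < n) (hj : j ≤ n) :
    |Real.log ((n.choose j : ℝ) / 2 ^ n)
      - (logBinomialConst n - logBinomialPoly n (normSq n j))|
      ≤ 1536 * (1 + normSq n j ^ 4) / n ^ 3 := by
  rcases le_total |2 * (j : ℝ) - n| (n / 2) with h | h
  · refine (abs_log_choose_sub_le_of_central hn hj h).trans ?_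
    have := normSq_nonneg n j
    gcongr
    norm_num
  · exact abs_log_choose_sub_le_of_tail hn hj h

end LocalExpansion

/-! ### Expansions of the entropy and of the variance of the logarithm -/

section EntropyExpansion

open Finset

/-- The logarithm of the symmetric binomial law with `n` trials. -/
noncomputable def logBinomial (n j : ℕ) : ℝ := Real.log ((n.choose j : ℝ) / 2 ^ n)

/-- The main part of the expansion of `-logBinomial`, up to its constant term. -/
noncomputable def mainPart (n j : ℕ) : ℝ := logBinomialPoly n (normSq n j)

/-- The remainder of the expansion of `logBinomial`. -/
noncomputable def remainder (n j : ℕ) : ℝ :=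
  logBinomial n j - (logBinomialConst n - mainPart n j)

theorem exists_binomialAvg_one_add_normSq_pow_le (k : ℕ) :
    ∃ B : ℝ, 0 ≤ B ∧ ∀ n : ℕ, 0 < n → binomialAvg n (fun j => 1 + normSq n j ^ k) ≤ B := by
  refine ⟨1 + (2 * k).factorial * Real.exp (1 / 2), by positivity, fun n hn => ?_⟩
  have : (fun j => 1 + normSq n j ^ k) = 1 + normSq n ^ k := rfl
  rw [this, map_add, binomialAvg_one]
  linarith [binomialAvg_normSq_pow_le hn k]

/-- A function bounded by a multiple of `1 + x ^ k`, with `x` the normalized square, has a bounded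
average. -/
theorem exists_abs_binomialAvg_le {g : ℕ → ℕ → ℝ} {ε : ℕ → ℝ} {C : ℝ} {k : ℕ}
    (hε : ∀ n, 0 ≤ ε n) (hC : 0 ≤ C)
    (hg : ∀ n, 0 < n → ∀ j ≤ n, |g n j| ≤ C * ε n * (1 + normSq n j ^ k)) :
    ∃ K : ℝ, 0 ≤ K ∧ ∀ n : ℕ, 0 < n → |binomialAvg n (g n)| ≤ K * ε n := by
  obtain ⟨B, hB0, hB⟩ := exists_binomialAvg_one_add_normSq_pow_le k
  refine ⟨C * B, by positivity, fun n hn => ?_⟩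
  have h := abs_binomialAvg_le (h := (C * ε n) • fun j => 1 + normSq n j ^ k) (hg n hn)
  rw [map_smul, smul_eq_mul] at h
  have := mul_le_mul_of_nonneg_left (hB n hn) (mul_nonneg hC (hε n))
  linarith

theorem abs_remainder_le {n : ℕ} (hn : 0 < n) {j : ℕ} (hj : j ≤ n) :
    |remainder n j| ≤ 1536 * (1 / (n : ℝ) ^ 3) * (1 + normSq n j ^ 4) :=
  (abs_log_choose_sub_le hn hj).trans (le_of_eq (by ring))

theorem mainPart_eq (n : ℕ) : mainPart n
    = (1 / 2 - 1 / n / 2 + (1 / n) ^ 2 / 3 : ℝ) • normSq n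
      + (1 / n / 12 - (1 / n) ^ 2 / 4 : ℝ) • normSq n ^ 2
      + ((1 / n) ^ 2 / 30 : ℝ) • normSq n ^ 3 := by
  funext j
  simp only [mainPart, logBinomialPoly, Pi.add_apply, Pi.smul_apply, Pi.pow_apply, smul_eq_mul]
  ring

theorem one_div_mem_Icc {n : ℕ} (hn : 0 < n) : (1 / n : ℝ) ∈ Set.Icc (0 : ℝ) 1 := by
  have : (1 : ℝ) ≤ n := by exact_mod_cast hn
  exact ⟨by positivity, by rw [div_le_one (by positivity)]; exact this⟩

theorem abs_mainPart_le {n : ℕ} (hn : 0 < n) (j : ℕ) :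
    |mainPart n j| ≤ 3 * (1 + normSq n j ^ 4) := by
  obtain ⟨h0, h1⟩ := one_div_mem_Icc hn
  have hx := normSq_nonneg n j
  rw [mainPart_eq]
  simp only [Pi.add_apply, Pi.smul_apply, Pi.pow_apply, smul_eq_mul]
  generalize normSq n j = x at hx
  generalize (1 / n : ℝ) = t at h0 h1
  have t2 : t ^ 2 ≤ 1 := pow_le_one₀ h0 h1
  have t2' : 0 ≤ t ^ 2 := by positivity
  have a1 : |1 / 2 - t / 2 + t ^ 2 / 3| ≤ 1 := by rw [abs_le]; constructor <;> linarith
  have a2 : |t / 12 - t ^ 2 / 4| ≤ 1 := by rw [abs_le]; constructor <;> linarith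
  have a3 : |t ^ 2 / 30| ≤ 1 := by rw [abs_le]; constructor <;> linarith
  have h2 : x ^ 2 ≤ 1 + x ^ 4 := by nlinarith [sq_nonneg (x ^ 2 - 1)]
  have h3 : x ^ 3 ≤ 1 + x ^ 4 := by nlinarith [sq_nonneg (x ^ 2 - x), sq_nonneg (x ^ 2 - 1)]
  have h1 : x ≤ 1 + x ^ 4 := by nlinarith [sq_nonneg (x - 1), sq_nonneg (x ^ 2 - 1)]
  have bound : ∀ a y : ℝ, |a| ≤ 1 → 0 ≤ y → |a * y| ≤ y := fun a y ha hy => by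
    rw [abs_mul, abs_of_nonneg hy]
    exact mul_le_of_le_one_left hy ha
  have b1 := bound _ x a1 hx
  have b2 := bound _ (x ^ 2) a2 (by positivity)
  have b3 := bound _ (x ^ 3) a3 (by positivity)
  refine (abs_add_three _ _ _).trans ?_
  linarith

theorem binomialAvg_mainPart {n : ℕ} (hn : 0 < n) : binomialAvg n (mainPart n)
    = 1 / 2 - 1 / n / 4 - (1 / n) ^ 2 / 12 - (1 / n) ^ 3 / 2 + 8 / 15 * (1 / n) ^ 4 := by
  obtain ⟨m1, m2, m3, -⟩ := binomialAvg_normSq_pow hn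
  rw [mainPart_eq]
  simp only [map_add, map_smul, smul_eq_mul, m1, m2, m3]
  ring

theorem exists_abs_binomialAvg_remainder_le :
    ∃ K : ℝ, 0 ≤ K ∧ ∀ n : ℕ, 0 < n → |binomialAvg n (remainder n)| ≤ K * (1 / (n : ℝ) ^ 3) :=
  exists_abs_binomialAvg_le (k := 4) (C := 1536) (fun n => by positivity) (by norm_num)
    fun _ hn _ hj => abs_remainder_le hn hj

theorem logBinomial_eq (n : ℕ) :
    logBinomial n = logBinomialConst n • 1 - (mainPart n - remainder n) := by
  funext j
  simp only [remainder, Pi.sub_apply, Pi.smul_apply, Pi.one_apply, smul_eq_mul]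
  ring

theorem one_div_cube_nonneg (n : ℕ) : 0 ≤ 1 / (n : ℝ) ^ 3 := by positivity

/-- The entropy of the symmetric binomial law. -/
theorem exists_abs_entropy_binomial_sub_le :
    ∃ K : ℝ, 0 ≤ K ∧ ∀ n : ℕ, 0 < n →
      |-binomialAvg n (logBinomial n)
        - (1 / 2 * Real.log (Real.pi * Real.exp 1 * n / 2) - 1 / (12 * (n : ℝ) ^ 2))|
        ≤ K * (1 / (n : ℝ) ^ 3) := by
  obtain ⟨K, hK, h⟩ := exists_abs_binomialAvg_remainder_le
  refine ⟨K + 2, by positivity, fun n hn => ?_⟩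
  have hn' : (0 : ℝ) < n := by exact_mod_cast hn
  obtain ⟨h0, h1⟩ := one_div_mem_Icc hn
  have hlog : Real.log (Real.pi * Real.exp 1 * n / 2) = Real.log (Real.pi * n / 2) + 1 := by
    rw [show Real.pi * Real.exp 1 * n / 2 = Real.pi * n / 2 * Real.exp 1 by ring,
      Real.log_mul (by positivity) (by positivity), Real.log_exp]
  have e : -binomialAvg n (logBinomial n)
      - (1 / 2 * Real.log (Real.pi * Real.exp 1 * n / 2) - 1 / (12 * (n : ℝ) ^ 2))
      = (1 / n) ^ 3 * (-1 / 2 + 8 / 15 * (1 / n)) - binomialAvg n (remainder n) := by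
    rw [logBinomial_eq, map_sub, map_sub, map_smul, binomialAvg_one, binomialAvg_mainPart hn, hlog,
      smul_eq_mul, logBinomialConst]
    ring
  rw [e]
  refine (abs_sub _ _).trans ?_
  have h2 : |(1 / n : ℝ) ^ 3 * (-1 / 2 + 8 / 15 * (1 / n))| ≤ (1 / n : ℝ) ^ 3 * 2 :=
    abs_mul_le_of_nonneg (by positivity) (by rw [abs_le]; constructor <;> linarith)
  rw [one_div_pow] at h2 ⊢
  linarith [h n hn]

theorem exists_abs_variance_mainPart_sub_le :
    ∃ K : ℝ, 0 ≤ K ∧ ∀ n : ℕ, 0 < n →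
      |binomialAvg n (mainPart n ^ 2) - binomialAvg n (mainPart n) ^ 2
        - (1 / 2 - 1 / (2 * (n : ℝ)) - 1 / 2 * (1 / (n : ℝ) ^ 2))| ≤ K * (1 / (n : ℝ) ^ 3) := by
  set B5 : ℝ := (2 * 5).factorial * Real.exp (1 / 2) with hB5
  set B6 : ℝ := (2 * 6).factorial * Real.exp (1 / 2) with hB6
  refine ⟨300 + B5 + B6, by positivity, fun n hn => ?_⟩
  obtain ⟨m1, m2, m3, m4⟩ := binomialAvg_normSq_pow hn
  have hM5 := binomialAvg_normSq_pow_le hn 5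
  have hM6 := binomialAvg_normSq_pow_le hn 6
  have hnn : ∀ k, 0 ≤ binomialAvg n (normSq n ^ k) := fun k => by
    rw [← map_zero (binomialAvg n)]
    exact binomialAvg_mono fun j _ => pow_nonneg (normSq_nonneg n j) k
  have h5 := hnn 5
  have h6 := hnn 6
  have hsq : ∀ (a b c : ℝ) (X : ℕ → ℝ), (a • X + b • X ^ 2 + c • X ^ 3) ^ 2
      = a ^ 2 • X ^ 2 + (2 * a * b) • X ^ 3 + (b ^ 2 + 2 * a * c) • X ^ 4
        + (2 * b * c) • X ^ 5 + c ^ 2 • X ^ 6 := by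
    intro a b c X
    funext j
    simp only [Pi.add_apply, Pi.smul_apply, Pi.pow_apply, smul_eq_mul]
    ring
  rw [binomialAvg_mainPart hn, mainPart_eq, hsq]
  simp only [map_add, map_smul, smul_eq_mul, m2, m3, m4]
  set M5 := binomialAvg n (normSq n ^ 5)
  set M6 := binomialAvg n (normSq n ^ 6)
  obtain ⟨h0, h1⟩ := one_div_mem_Icc hn
  have hrew : ∀ (x : ℝ) (k : ℕ), x / (n : ℝ) ^ k = x * (1 / n) ^ k := fun x k => by
    rw [one_div_pow]; ring
  have hrew1 : ∀ x : ℝ, x / (n : ℝ) = x * (1 / n) := fun x => by ring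
  rw [show 1 / (2 * (n : ℝ)) = 1 / 2 * (1 / n) by ring, hrew 16, hrew 588, hrew 272, hrew 1 2,
    hrew 1 3, hrew1 2, hrew1 30, hrew1 420]
  generalize (1 / n : ℝ) = t at h0 h1
  have e : (1 / 2 - t / 2 + t ^ 2 / 3) ^ 2 * (3 - 2 * t)
      + 2 * (1 / 2 - t / 2 + t ^ 2 / 3) * (t / 12 - t ^ 2 / 4) * (15 - 30 * t + 16 * t ^ 2)
      + ((t / 12 - t ^ 2 / 4) ^ 2 + 2 * (1 / 2 - t / 2 + t ^ 2 / 3) * (t ^ 2 / 30))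
        * (105 - 420 * t + 588 * t ^ 2 - 272 * t ^ 3)
      + 2 * (t / 12 - t ^ 2 / 4) * (t ^ 2 / 30) * M5 + (t ^ 2 / 30) ^ 2 * M6
      - (1 / 2 - t / 4 - t ^ 2 / 12 - t ^ 3 / 2 + 8 / 15 * t ^ 4) ^ 2
      - (1 / 2 - 1 / 2 * t - 1 / 2 * (1 * t ^ 2))
      = t ^ 3 * (-127 / 12 + 2128 / 45 * t - 7271 / 90 * t ^ 2 + 1213 / 18 * t ^ 3
        - 1013 / 45 * t ^ 4 - 64 / 225 * t ^ 5 + (1 / 180 - t / 60) * M5 + t / 900 * M6) := by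
    ring
  rw [e, one_mul, mul_comm (300 + B5 + B6)]
  refine abs_mul_le_of_nonneg (by positivity) ?_
  have hp : ∀ k, t ^ k ≤ 1 := fun k => pow_le_one₀ h0 h1
  have hp' : ∀ k, 0 ≤ t ^ k := fun k => by positivity
  have s5 := mul_nonneg h0 h5
  have s6 := mul_nonneg h0 h6
  have r5 := mul_le_mul_of_nonneg_right h1 h5
  have r6 := mul_le_mul_of_nonneg_right h1 h6
  rw [abs_le]
  constructor <;> linarith [hp 2, hp 3, hp 4, hp 5, hp' 2, hp' 3, hp' 4, hp' 5]

/-- The variance of the logarithm of the symmetric binomial law. -/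
theorem exists_abs_variance_logBinomial_sub_le :
    ∃ K : ℝ, 0 ≤ K ∧ ∀ n : ℕ, 0 < n →
      |binomialAvg n (logBinomial n ^ 2) - binomialAvg n (logBinomial n) ^ 2
        - (1 / 2 - 1 / (2 * (n : ℝ)) - 1 / 2 * (1 / (n : ℝ) ^ 2))| ≤ K * (1 / (n : ℝ) ^ 3) := by
  obtain ⟨K₀, hK₀, h₀⟩ := exists_abs_variance_mainPart_sub_le
  obtain ⟨K₁, hK₁, h₁⟩ := exists_abs_binomialAvg_remainder_le
  have hsq : ∀ x : ℝ, (1 + x ^ 4) * (1 + x ^ 4) ≤ 2 * (1 + x ^ 8) := fun x => by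
    nlinarith [sq_nonneg (x ^ 4 - 1)]
  obtain ⟨K₂, hK₂, h₂⟩ := exists_abs_binomialAvg_le (k := 8) (C := 3 * 1536 * 2)
    (g := fun n => mainPart n * remainder n) (ε := fun n => 1 / (n : ℝ) ^ 3)
    (fun n => by positivity) (by norm_num) fun n hn j hj => by
      rw [Pi.mul_apply, abs_mul]
      refine (mul_le_mul (abs_mainPart_le hn j) (abs_remainder_le hn hj) (abs_nonneg _)
        (by positivity)).trans ?_
      have := mul_le_mul_of_nonneg_left (hsq (normSq n j)) (one_div_cube_nonneg n)
      linarith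
  obtain ⟨K₃, hK₃, h₃⟩ := exists_abs_binomialAvg_le (k := 8) (C := 1536 * 1536 * 2)
    (g := fun n => remainder n ^ 2) (ε := fun n => 1 / (n : ℝ) ^ 3 * (1 / (n : ℝ) ^ 3))
    (fun n => by positivity) (by norm_num) fun n hn j hj => by
      rw [Pi.pow_apply, sq, abs_mul]
      refine (mul_le_mul (abs_remainder_le hn hj) (abs_remainder_le hn hj) (abs_nonneg _)
        (by positivity)).trans ?_
      have := mul_le_mul_of_nonneg_left (hsq (normSq n j))
        (mul_nonneg (one_div_cube_nonneg n) (one_div_cube_nonneg n))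
      linarith
  refine ⟨K₀ + 2 * K₂ + K₃ + 2 * (2 * K₁) + K₁ * K₁, by positivity, fun n hn => ?_⟩
  have hε0 := one_div_cube_nonneg n
  have hε1 : 1 / (n : ℝ) ^ 3 ≤ 1 := by
    rw [← one_div_pow]; exact pow_le_one₀ (one_div_mem_Icc hn).1 (one_div_mem_Icc hn).2
  have b₀ := h₀ n hn
  have b₁ := h₁ n hn
  have b₂ := h₂ n hn
  have b₃ := h₃ n hn
  have bq : |binomialAvg n (mainPart n)| ≤ 2 := by
    obtain ⟨t0, t1⟩ := one_div_mem_Icc hn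
    rw [binomialAvg_mainPart hn]
    generalize (1 / n : ℝ) = t at t0 t1
    have hp : ∀ k, t ^ k ≤ 1 := fun k => pow_le_one₀ t0 t1
    have hp' : ∀ k, 0 ≤ t ^ k := fun k => by positivity
    rw [abs_le]
    constructor <;> linarith [hp 2, hp 3, hp 4, hp' 2, hp' 3, hp' 4]
  have hfun : logBinomial n ^ 2 = (logBinomialConst n ^ 2) • 1
      - (2 * logBinomialConst n) • (mainPart n - remainder n)
      + (mainPart n ^ 2 - (2 : ℝ) • (mainPart n * remainder n) + remainder n ^ 2) := by
    rw [logBinomial_eq]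
    funext j
    simp only [Pi.add_apply, Pi.sub_apply, Pi.smul_apply, Pi.pow_apply, Pi.mul_apply, Pi.one_apply,
      smul_eq_mul]
    ring
  have hlin : binomialAvg n (logBinomial n)
      = logBinomialConst n - (binomialAvg n (mainPart n) - binomialAvg n (remainder n)) := by
    rw [logBinomial_eq]
    simp only [map_sub, map_smul, binomialAvg_one, smul_eq_mul, mul_one]
  rw [hlin, hfun]
  simp only [map_sub, map_add, map_smul, binomialAvg_one, smul_eq_mul, mul_one]
  generalize 1 / (n : ℝ) ^ 3 = ε at *
  generalize binomialAvg n (mainPart n) = q at *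
  generalize binomialAvg n (remainder n) = r at *
  generalize binomialAvg n (mainPart n * remainder n) = qr at *
  generalize binomialAvg n (remainder n ^ 2) = rr at *
  generalize binomialAvg n (mainPart n ^ 2) = qq at *
  have c1 : |q * r| ≤ 2 * (K₁ * ε) := by
    rw [abs_mul]; exact mul_le_mul bq b₁ (abs_nonneg _) (by norm_num)
  have c2 : |r * r| ≤ (K₁ * ε) * (K₁ * ε) := by
    rw [abs_mul]; exact mul_le_mul b₁ b₁ (abs_nonneg _) (by positivity)
  have hεε : ε * ε ≤ ε := mul_le_of_le_one_left hε0 hε1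
  have c3 := mul_le_mul_of_nonneg_left hεε hK₃
  have c4 := mul_le_mul_of_nonneg_left hεε (mul_nonneg hK₁ hK₁)
  rw [abs_le] at *
  constructor <;> nlinarith [b₀.1, b₀.2, b₂.1, b₂.2, b₃.1, b₃.2, c1.1, c1.2, c2.1, c2.2]

end EntropyExpansion

/-! ### Expansions of the mutual information and of the dispersion -/

namespace RAC

theorem coeff_sumPoly_equiprobable {k j : ℕ} (hj : j ≤ k) :
    (sumPoly (fun i => equiprobable k i 1) Finset.univ).coeff j = (k.choose j : ℝ) / 2 ^ k := by
  have h : (sumPoly (fun i => equiprobable k i 1) Finset.univ).coeff j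
      = (sumPoly (fun _ : Fin k => (1 / 2 : ℝ)) Finset.univ).coeff j := rfl
  rw [h, sumPoly_const, coeff_bernoulli_pow, Finset.card_univ, Fintype.card_fin,
    show (1 : ℝ) - 1 / 2 = 1 / 2 by norm_num, mul_assoc, ← pow_add, Nat.add_sub_cancel' hj,
    one_div_pow, mul_one_div]

theorem mutualInfo_equiprobable (δ : ℝ) (k : ℕ) :
    mutualInfo (adderErasure δ k) (equiprobable k)
      = (1 - δ) * -binomialAvg k (logBinomial k) := by
  rw [mutualInfo_adderErasure δ (equiprobable_mem_inputLaws k), sumEntropy, binomialAvg_apply,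
    Fintype.card_fin, ← Finset.sum_neg_distrib]
  congr 1
  refine Finset.sum_congr rfl fun j hj => ?_
  rw [coeff_sumPoly_equiprobable (Nat.lt_succ_iff.1 (Finset.mem_range.1 hj)), Real.negMulLog,
    logBinomial]
  ring

/-- The erasures contribute the variance of a Bernoulli variable times the squared entropy. -/
theorem dispersion_equiprobable (δ : ℝ) (k : ℕ) :
    dispersion (adderErasure δ k) (equiprobable k)
      = (1 - δ) * (binomialAvg k (logBinomial k ^ 2) - binomialAvg k (logBinomial k) ^ 2
        + δ * (-binomialAvg k (logBinomial k)) ^ 2) := by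
  rw [dispersion_adderErasure δ (equiprobable_mem_inputLaws k), mutualInfo_equiprobable]
  set I := (1 - δ) * -binomialAvg k (logBinomial k) with hI
  have h : ∑ j ∈ Finset.range (k + 1),
      (sumPoly (fun i => equiprobable k i 1) Finset.univ).coeff j *
        (-Real.log ((sumPoly (fun i => equiprobable k i 1) Finset.univ).coeff j) - I) ^ 2
      = binomialAvg k (logBinomial k ^ 2 + (2 * I) • logBinomial k + (I ^ 2) • 1) := by
    rw [binomialAvg_apply]
    refine Finset.sum_congr rfl fun j hj => ?_
    rw [coeff_sumPoly_equiprobable (Nat.lt_succ_iff.1 (Finset.mem_range.1 hj))]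
    simp only [Pi.add_apply, Pi.smul_apply, Pi.pow_apply, Pi.one_apply, smul_eq_mul, logBinomial]
    ring
  rw [h]
  simp only [map_add, map_smul, binomialAvg_one, smul_eq_mul, hI]
  ring

theorem isBigO_mutualInfo (δ : ℝ) :
    (fun k : ℕ => mutualInfo (adderErasure δ k) (equiprobable k) -
        (1 - δ) * (1 / 2 * Real.log (Real.pi * Real.exp 1 * k / 2) - 1 / (12 * (k : ℝ) ^ 2)))
      =O[Filter.atTop] (fun k : ℕ => 1 / (k : ℝ) ^ 3) := by
  obtain ⟨K, -, h⟩ := exists_abs_entropy_binomial_sub_le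
  refine Asymptotics.IsBigO.of_bound (|1 - δ| * K) ?_
  filter_upwards [Filter.eventually_gt_atTop 0] with k hk
  rw [mutualInfo_equiprobable, ← mul_sub, Real.norm_eq_abs, abs_mul, Real.norm_eq_abs,
    abs_of_nonneg (one_div_cube_nonneg k), mul_assoc |1 - δ|]
  exact mul_le_mul_of_nonneg_left (h k hk) (abs_nonneg _)

theorem isBigO_dispersion {δ : ℝ} (hδ : δ ∈ Set.Icc (0 : ℝ) 1) :
    (fun k : ℕ => dispersion (adderErasure δ k) (equiprobable k) -
        (1 - δ) * (δ / 4 * Real.log (Real.pi * Real.exp 1 * k / 2) ^ 2 + 1 / 2 - 1 / (2 * (k : ℝ))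
          - (1 / 2 + δ * Real.log (Real.pi * Real.exp 1 * k / 2) / 12) * (1 / (k : ℝ) ^ 2)))
      =O[Filter.atTop] (fun k : ℕ => Real.log k / (k : ℝ) ^ 3) := by
  obtain ⟨K, hK, hH⟩ := exists_abs_entropy_binomial_sub_le
  obtain ⟨K', hK', hV⟩ := exists_abs_variance_logBinomial_sub_le
  refine Asymptotics.IsBigO.of_bound (K' + (4 * K + 1 + K ^ 2)) ?_
  filter_upwards [Filter.eventually_ge_atTop 16] with k hk
  have hk0 : 0 < k := by omega
  have hk' : (0 : ℝ) < k := by exact_mod_cast hk0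
  have hk16 : (16 : ℝ) ≤ k := by exact_mod_cast hk
  have bH := hH k hk0
  have bV := hV k hk0
  have hlog1 : 1 ≤ Real.log k := by
    rw [Real.le_log_iff_exp_le hk']
    linarith [Real.exp_one_lt_d9]
  -- `π e / 2 ≤ 16 ≤ k`, so the logarithm in the expansion is at most `2 log k`
  have hL : |Real.log (Real.pi * Real.exp 1 * k / 2)| ≤ 2 * Real.log k := by
    have hπ := Real.pi_gt_three
    have hπ' := Real.pi_lt_four
    have he := Real.exp_one_gt_d9
    have he' := Real.exp_one_lt_d9
    have l0 : 0 ≤ Real.log (Real.pi * Real.exp 1 * k / 2) := by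
      refine Real.log_nonneg ?_
      have : 1 ≤ Real.pi * Real.exp 1 := by nlinarith
      nlinarith
    rw [abs_of_nonneg l0, ← Nat.cast_two, ← Real.log_pow]
    refine Real.log_le_log (by positivity) ?_
    have : Real.pi * Real.exp 1 ≤ 16 := by nlinarith
    push_cast
    nlinarith
  rw [dispersion_equiprobable, ← mul_sub, Real.norm_eq_abs, abs_mul, Real.norm_eq_abs,
    abs_of_nonneg (show 0 ≤ Real.log k / (k : ℝ) ^ 3 by positivity),
    show Real.log k / (k : ℝ) ^ 3 = Real.log k * (1 / (k : ℝ) ^ 3) by ring]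
  set L := Real.log (Real.pi * Real.exp 1 * k / 2) with hLdef
  set H := -binomialAvg k (logBinomial k) with hHdef
  set V := binomialAvg k (logBinomial k ^ 2) - binomialAvg k (logBinomial k) ^ 2 with hVdef
  set ε := 1 / (k : ℝ) ^ 3 with hε
  set e := H - (1 / 2 * L - 1 / (12 * (k : ℝ) ^ 2)) with he
  obtain ⟨t0, t1⟩ := one_div_mem_Icc hk0
  have hε0 : 0 ≤ ε := by positivity
  have hε1 : ε ≤ 1 := by rw [hε, ← one_div_pow]; exact pow_le_one₀ t0 t1
  have hδ1 : |1 - δ| ≤ 1 := by rw [abs_le]; constructor <;> linarith [hδ.1, hδ.2]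
  have hsplit : V + δ * H ^ 2 - (δ / 4 * L ^ 2 + 1 / 2 - 1 / (2 * (k : ℝ))
      - (1 / 2 + δ * L / 12) * (1 / (k : ℝ) ^ 2))
      = (V - (1 / 2 - 1 / (2 * (k : ℝ)) - 1 / 2 * (1 / (k : ℝ) ^ 2)))
        + δ * (e * L - e * (1 / k) ^ 2 / 6 + ε * (1 / k) / 144 + e * e) := by
    rw [he, hε]
    field_simp
    ring
  have hδe : |δ * (e * L - e * (1 / k) ^ 2 / 6 + ε * (1 / k) / 144 + e * e)|
      ≤ (4 * K + 1 + K ^ 2) * (Real.log k * ε) := by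
    have p1 : |e * L| ≤ K * ε * (2 * Real.log k) := by
      rw [abs_mul]; exact mul_le_mul bH hL (abs_nonneg _) (by positivity)
    have p2 : |e * (1 / k) ^ 2 / 6| ≤ K * ε := by
      rw [abs_div, abs_mul, abs_of_nonneg (by positivity : (0 : ℝ) ≤ (1 / k) ^ 2),
        abs_of_pos (by norm_num : (0 : ℝ) < 6)]
      have : |e| * (1 / k) ^ 2 ≤ |e| :=
        mul_le_of_le_one_right (abs_nonneg _) (pow_le_one₀ t0 t1)
      linarith [abs_nonneg e, mul_nonneg hK hε0]
    have p3 : |ε * (1 / k) / 144| ≤ ε := by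
      rw [abs_of_nonneg (by positivity)]
      have : ε * (1 / k) ≤ ε := mul_le_of_le_one_right hε0 t1
      linarith
    have p4 : |e * e| ≤ K ^ 2 * ε := by
      rw [abs_mul]
      refine (mul_le_mul bH bH (abs_nonneg _) (by positivity)).trans ?_
      have := mul_le_mul_of_nonneg_left (mul_le_of_le_one_left hε0 hε1) (sq_nonneg K)
      linarith
    have hsum : |e * L - e * (1 / k) ^ 2 / 6 + ε * (1 / k) / 144 + e * e|
        ≤ (4 * K + 1 + K ^ 2) * (Real.log k * ε) := by
      have hεl : ε ≤ Real.log k * ε := le_mul_of_one_le_left hε0 hlog1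
      have m1 := mul_le_mul_of_nonneg_left hεl hK
      have m2 := mul_le_mul_of_nonneg_left hεl (sq_nonneg K)
      have m3 : 0 ≤ K * (Real.log k * ε) := by positivity
      rw [abs_le] at p1 p2 p3 p4 ⊢
      constructor <;> linarith [p1.1, p1.2, p2.1, p2.2, p3.1, p3.2, p4.1, p4.2]
    rw [abs_mul]
    refine (mul_le_of_le_one_left (abs_nonneg _) ?_).trans hsum
    rw [abs_of_nonneg hδ.1]
    exact hδ.2
  refine (mul_le_of_le_one_left (abs_nonneg _) hδ1).trans ?_
  rw [hsplit, add_mul]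
  refine (abs_add_le _ _).trans (add_le_add (bV.trans ?_) hδe)
  exact mul_le_mul_of_nonneg_left (le_mul_of_one_le_left hε0 hlog1) hK'

end RAC

theorem mainTheorem6 (δ : ℝ) (hδ : δ ∈ Set.Icc (0 : ℝ) 1) :
    -- the equiprobable distribution is an optimal input distribution for every number of
    -- transmitters, and the only one unless every output is erased
    (∀ k : ℕ, RAC.equiprobable k ∈ RAC.inputLaws k (Fin 2) ∧
      IsMaxOn (RAC.mutualInfo (RAC.adderErasure δ k)) (RAC.inputLaws k (Fin 2))
        (RAC.equiprobable k)) ∧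
    (δ < 1 → ∀ k : ℕ, ∀ P ∈ RAC.inputLaws k (Fin 2),
      IsMaxOn (RAC.mutualInfo (RAC.adderErasure δ k)) (RAC.inputLaws k (Fin 2)) P →
        P = RAC.equiprobable k) ∧
    -- it achieves the sum-rate capacity
    (∀ k : ℕ, RAC.mutualInfo (RAC.adderErasure δ k) (RAC.equiprobable k) =
      RAC.sumRateCapacity (RAC.adderErasure δ k)) ∧
    -- expansion of the mutual information
    (fun k : ℕ => RAC.mutualInfo (RAC.adderErasure δ k) (RAC.equiprobable k) -
        (1 - δ) * (1 / 2 * Real.log (Real.pi * Real.exp 1 * k / 2) - 1 / (12 * (k : ℝ) ^ 2)))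
      =O[Filter.atTop] (fun k : ℕ => 1 / (k : ℝ) ^ 3) ∧
    -- expansion of the dispersion
    (fun k : ℕ => RAC.dispersion (RAC.adderErasure δ k) (RAC.equiprobable k) -
        (1 - δ) * (δ / 4 * Real.log (Real.pi * Real.exp 1 * k / 2) ^ 2 + 1 / 2 - 1 / (2 * (k : ℝ))
          - (1 / 2 + δ * Real.log (Real.pi * Real.exp 1 * k / 2) / 12) * (1 / (k : ℝ) ^ 2)))
      =O[Filter.atTop] (fun k : ℕ => Real.log k / (k : ℝ) ^ 3) := by

  refine ⟨fun k => ⟨RAC.equiprobable_mem_inputLaws k, RAC.isMaxOn_equiprobable hδ k⟩,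
    fun hδ1 k P hP hmax => ?_, fun k => ?_, RAC.isBigO_mutualInfo δ, RAC.isBigO_dispersion hδ⟩
  · by_contra hne
    exact absurd (hmax (RAC.equiprobable_mem_inputLaws k))
      (not_le.2 (RAC.mutualInfo_lt_equiprobable hδ1 hP hne))
  · have hgreatest : IsGreatest (RAC.mutualInfo (RAC.adderErasure δ k) '' RAC.inputLaws k (Fin 2))
        (RAC.mutualInfo (RAC.adderErasure δ k) (RAC.equiprobable k)) := by
      refine ⟨⟨_, RAC.equiprobable_mem_inputLaws k, rfl⟩, ?_⟩
      rintro _ ⟨P, hP, rfl⟩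
      exact RAC.isMaxOn_equiprobable hδ k hP
    exact hgreatest.csSup_eq.symm
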